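/- Let $\mathbb{K}$ be an algebraically closed field. A plane curve of degree $d$ is the zero locus $C=V(E)\subset\mathbb{P}^2$ of an irreducible form $E\in\mathbb{K}[X_1,X_2,X_3]$ of degree $d$. It is called parameterizable by lines if there are linear forms $F_1,F_2\in\mathbb{K}[X_1,X_2,X_3]$ without common factors and forms $u_1,u_2,u_3\in\mathbb{K}[T_1,T_2]$ of the same degree and without common factors such that $\phi=(u_1:u_2:u_3)$ maps $\mathbb{P}^1$ to $C$ and the rational map $\psi=(F_1:F_2):C\dashrightarrow\mathbb{P}^1$ is inverse to $\phi$ (both compositions are the identity as rational maps). A quadratic transformation is a birational map $\mathbb{P}^2\dashrightarrow\mathbb{P}^2$ given by three quadratic forms without common factors. (a) Let $C_0$ be a plane curve of degree $d_0>1$ parameterizable by lines, and let $\Lambda$ be a quadratic transformation whose inverse is also given by three quadratic forms without common factors. Then the Zariski closure $\overline{\Lambda(C_0)}$ of the image of the part of $C_0$ on which $\Lambda$ is defined is a plane curve, and its degree $D_0$ satisfies $$d_0-1\le D_0\le 2d_0 .$$ (b) Both bounds are sharp: for every $d_0>1$ there are $C_0$ and $\Lambda$ as in (a), with $\deg C_0=d_0$,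 such that $D_0=d_0-1$, and there are $C_0$ and $\Lambda$ as in (a), with $\deg C_0=d_0$, such that $D_0=2d_0$. In both cases $C_0$ can be chosen to have multiplicity $d_0-1$ at $(0:0:1)$. -/

import Mathlib

open MvPolynomial

/-- The projective plane over `K`, with homogeneous coordinates indexed by `Fin 3`. -/
abbrev ProjPlane (K : Type*) [Field K] : Type _ := Projectivization K (Fin 3 → K)

/-- A family of polynomials has no common factor: every common divisor is a unit. -/
def NoCommonFactor {R ι : Type*} [CommRing R] (f : ι → R) : Prop :=
  ∀ g : R, (∀ i, g ∣ f i) → IsUnit g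

/-- The form `f` vanishes at the point `p` (only meaningful for homogeneous `f`, for which it does
not depend on the homogeneous coordinates chosen, see `vanishesAt_mk_iff`). -/
def VanishesAt {K : Type*} [Field K] (f : MvPolynomial (Fin 3) K) (p : ProjPlane K) : Prop :=
  eval p.rep f = 0

theorem vanishesAt_mk_iff {K : Type*} [Field K] {f : MvPolynomial (Fin 3) K} {n : ℕ}
    (hf : f.IsHomogeneous n) (v : Fin 3 → K) (hv : v ≠ 0) :
    VanishesAt f (Projectivization.mk K v hv) ↔ eval v f = 0 := by
  obtain ⟨a, ha⟩ := Projectivization.exists_smul_eq_mk_rep K v hv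
  have h : eval (Projectivization.mk K v hv).rep f = (a : K) ^ n * eval v f := by
    rw [← ha, eval_eq', eval_eq', Finset.mul_sum]
    refine Finset.sum_congr rfl fun d hd => ?_
    have hdeg : ∑ i, d i = n := by
      rw [← hf (mem_support_iff.mp hd), Finsupp.weight_apply, Finsupp.sum_fintype _ _ (by simp)]
      simp
    simp only [Pi.smul_apply, Units.smul_def, smul_eq_mul, mul_pow, Finset.prod_mul_distrib]
    rw [Finset.prod_pow_eq_pow_sum, hdeg]
    ring
  unfold VanishesAt
  rw [h]
  simp

/-- The Zariski closure of a set of points of the projective plane: the common zeros of all the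
forms that vanish on it. -/
def zariskiClosure {K : Type*} [Field K] (Z : Set (ProjPlane K)) : Set (ProjPlane K) :=
  {p | ∀ (n : ℕ) (f : MvPolynomial (Fin 3) K), f.IsHomogeneous n →
    (∀ q ∈ Z, VanishesAt f q) → VanishesAt f p}

/-- An (irreducible) algebraic plane curve, given by an irreducible form; the curve is the zero
locus `PlaneCurve.points`. -/
structure PlaneCurve (K : Type*) [Field K] where
  degree : ℕ
  poly : MvPolynomial (Fin 3) K
  homogeneous : poly.IsHomogeneous degree
  irreducible : Irreducible poly

/-- The zero locus of the form that defines the curve. -/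
def PlaneCurve.points {K : Type*} [Field K] (C : PlaneCurve K) : Set (ProjPlane K) :=
  {p | VanishesAt C.poly p}

/-- The curve `C = V(E)` is parameterizable by the pair `(F 0, F 1)` of forms of degree `k`
without common factors: there are forms `u 0, u 1, u 2` in two variables, of the same degree and
without common factors, such that `φ = (u 0 : u 1 : u 2)` maps `ℙ¹` to `C` and
`ψ = (F 0 : F 1) : C ⇢ ℙ¹` is inverse to `φ` as a rational map. -/
def PlaneCurve.IsParameterizableBy {K : Type*} [Field K] (C : PlaneCurve K) (k : ℕ)
    (F : Fin 2 → MvPolynomial (Fin 3) K) : Prop :=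
  (∀ i, (F i).IsHomogeneous k) ∧ NoCommonFactor F ∧
  ∃ (n : ℕ) (u : Fin 3 → MvPolynomial (Fin 2) K),
    (∀ i, (u i).IsHomogeneous n) ∧ NoCommonFactor u ∧
    -- `φ` takes its values in `C`
    aeval u C.poly = 0 ∧
    -- `ψ ∘ φ` is defined and is the identity of `ℙ¹`
    (∃ i, aeval u (F i) ≠ 0) ∧ X 0 * aeval u (F 1) = X 1 * aeval u (F 0) ∧
    -- `φ ∘ ψ` is defined and is the identity of `C`
    (∃ i, ¬ C.poly ∣ aeval F (u i)) ∧
    ∀ i j, C.poly ∣ X j * aeval F (u i) - X i * aeval F (u j)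

/-- Parameterizable by a pair of linear forms. -/
def PlaneCurve.IsParameterizableByLines {K : Type*} [Field K] (C : PlaneCurve K) : Prop :=
  ∃ F : Fin 2 → MvPolynomial (Fin 3) K, C.IsParameterizableBy 1 F

/-- The curve has multiplicity `m` at `(0 : 0 : 1)`: in the affine chart `X 2 = 1`, the terms of
lowest degree of its equation have degree `m`. -/
def PlaneCurve.HasMultiplicityAtOrigin {K : Type*} [Field K] (C : PlaneCurve K) (m : ℕ) : Prop :=
  (∀ k < m, homogeneousComponent k
    (aeval ![(X 0 : MvPolynomial (Fin 2) K), X 1, 1] C.poly) = 0) ∧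
  homogeneousComponent m (aeval ![(X 0 : MvPolynomial (Fin 2) K), X 1, 1] C.poly) ≠ 0

/-- A rational map `ℙ² ⇢ ℙ²`, given by its reduced representation: three forms of the same degree
without common factors (these are unique up to a common non-zero scalar). -/
structure PlaneRationalMap (K : Type*) [Field K] where
  degree : ℕ
  form : Fin 3 → MvPolynomial (Fin 3) K
  homogeneous : ∀ i, (form i).IsHomogeneous degree
  noCommonFactor : NoCommonFactor form

/-- The image of (the part in the domain of definition of) a set of points. -/
def PlaneRationalMap.image {K : Type*} [Field K] (Λ : PlaneRationalMap K)
    (Z : Set (ProjPlane K)) : Set (ProjPlane K) :=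
  {q | ∃ p ∈ Z, ∃ h : (fun i => eval p.rep (Λ.form i)) ≠ 0, q = Projectivization.mk K _ h}

/-- The rational maps `Λ` and `M` are inverse to each other: both compositions are defined
(`h ≠ 0`) and equal to the identity as rational maps. -/
def PlaneRationalMap.IsInverse {K : Type*} [Field K] (Λ M : PlaneRationalMap K) : Prop :=
  (∃ h : MvPolynomial (Fin 3) K, h ≠ 0 ∧ ∀ i, aeval Λ.form (M.form i) = h * X i) ∧
  (∃ h : MvPolynomial (Fin 3) K, h ≠ 0 ∧ ∀ i, aeval M.form (Λ.form i) = h * X i)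

/-- A quadratic transformation: a birational map of the plane given by quadratic forms without
common factors. -/
def PlaneRationalMap.IsQuadraticTransformation {K : Type*} [Field K]
    (Λ : PlaneRationalMap K) : Prop :=
  Λ.degree = 2 ∧ ∃ M : PlaneRationalMap K, Λ.IsInverse M

/-- `Λ` is a quadratic transformation whose inverse is given by quadratic forms as well. -/
def PlaneRationalMap.IsQuadraticWithQuadraticInverse {K : Type*} [Field K]
    (Λ : PlaneRationalMap K) : Prop :=
  Λ.IsQuadraticTransformation ∧ ∃ M : PlaneRationalMap K, M.degree = 2 ∧ Λ.IsInverse M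

/-! ### Homogeneous polynomials: divisors, zeros and common factors. -/

section Forms

variable {K : Type*} [Field K]

/-! The degree of a rational plane curve is read off from a reduced parameterization. Since a pencil
of lines inverts `φ`, linear coordinates exist in which `φ = (X 0 * e : X 1 * e : f)` with `e`, `f`
coprime of degrees `n`, `n + 1` (`exists_normal_form`). The form `X 2 * e - f` then vanishes on the
curve, so `d₀ - 1 ≤ n` (`degree_le_of_normal_form`).

Composing `φ` with `Λ` gives three binary forms of degree `2 * (n + 1)`. Write them as `q * w i`
with `w` free of common factors. The heart of the lower bound is `deg q ≤ n + 2`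
(`totalDegree_le_of_dvd_quadratic`): if `q` were larger, the three quadrics would satisfy a linear
relation, which birationality forbids. Hence `w` has degree `m ≥ n`. The parameterization `w` still
has a rational inverse, namely the inverse of `Λ` followed by the pencil, and this forces `m ≤ D₀`
by comparing degrees of field extensions (`degree_le_of_birational_parameterization`). So `d₀ - 1 ≤
n ≤ m ≤ D₀`.

For the upper bound, pulling the equation of `C₀` back along the quadratic inverse gives a non-zero
form of degree `2 * d₀` that vanishes on the image. The equation of the image divides it, because
any irreducible polynomial vanishing along `w` generates the ideal of all those that do
(`dvd_of_aeval_eq_zero`).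

Sharpness is witnessed by `x ^ d = z y ^ (d - 1)`: one map has no base point on the curve, so
nothing cancels; for another, `q` reaches the extreme degree `n + 2`. -/

theorem aeval_smul_of_isHomogeneous {σ A : Type*} [CommRing A] [Algebra K A]
    {f : MvPolynomial σ K} {n : ℕ} (hf : f.IsHomogeneous n) (q : A) (w : σ → A) :
    aeval (fun i => q * w i) f = q ^ n * aeval w f := by
  rw [aeval_def, aeval_def, eval₂_eq, eval₂_eq, Finset.mul_sum]
  refine Finset.sum_congr rfl fun d hd => ?_
  have hdeg : ∑ i ∈ d.support, d i = n := by
    rw [← hf.degree_eq_sum_deg_support hd]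
  simp only [mul_pow, Finset.prod_mul_distrib]
  rw [Finset.prod_pow_eq_pow_sum, hdeg]
  ring

theorem isHomogeneous_linearCombination {σ ι : Type*} [Fintype ι] {n : ℕ}
    {w : ι → MvPolynomial σ K} (hw : ∀ i, (w i).IsHomogeneous n) (c : ι → K) :
    (∑ i, C (c i) * w i).IsHomogeneous n :=
  IsHomogeneous.sum _ _ _ fun i _ => (hw i).C_mul _

/-- The substitution `X i ↦ T * X i`, whose coefficients are the homogeneous components. -/
noncomputable def scaleHom (σ K : Type*) [Field K] :
    MvPolynomial σ K →ₐ[K] Polynomial (MvPolynomial σ K) :=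
  aeval fun i => Polynomial.X * Polynomial.C (X i)

theorem scaleHom_monomial {σ : Type*} (s : σ →₀ ℕ) (c : K) :
    scaleHom σ K (monomial s c) = Polynomial.monomial s.degree (monomial s c) := by
  have h := aeval_smul_of_isHomogeneous (isHomogeneous_monomial (n := s.degree) c rfl)
    (Polynomial.X : Polynomial (MvPolynomial σ K)) (fun i => Polynomial.C (X i))
  have h2 : aeval (fun i => Polynomial.C (X i : MvPolynomial σ K)) (monomial s c)
      = Polynomial.C (monomial s c) := by
    have : (aeval fun i => Polynomial.C (X i : MvPolynomial σ K)) =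
        (Polynomial.CAlgHom : MvPolynomial σ K →ₐ[MvPolynomial σ K] _).restrictScalars K := by
      ext i; simp
    rw [this]; rfl
  rw [scaleHom, h, h2, ← Polynomial.C_mul_X_pow_eq_monomial, mul_comm]

theorem scaleHom_coeff {σ : Type*} (p : MvPolynomial σ K) (k : ℕ) :
    (scaleHom σ K p).coeff k = homogeneousComponent k p := by
  induction p using MvPolynomial.induction_on' with
  | monomial s c =>
    rw [scaleHom_monomial, Polynomial.coeff_monomial,
      homogeneousComponent_of_mem (isHomogeneous_monomial c rfl)]
    simp [eq_comm]
  | add p q hp hq => simp [hp, hq]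

/-- Under `X i ↦ T * X i` the product becomes a single monomial in `T`. Highest and lowest degrees
in `T` are both additive, so each factor is a single monomial in `T` as well. -/
theorem isHomogeneous_of_dvd {σ : Type*} {a p : MvPolynomial σ K} {n : ℕ}
    (hp : p.IsHomogeneous n) (h0 : p ≠ 0) (h : a ∣ p) : a.IsHomogeneous a.totalDegree := by
  obtain ⟨b, rfl⟩ := h
  have ha0 : a ≠ 0 := left_ne_zero_of_mul h0
  have hinj : Function.Injective (scaleHom σ K) := by
    refine (injective_iff_map_eq_zero _).mpr fun f hf => ?_
    rw [← sum_homogeneousComponent f]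
    exact Finset.sum_eq_zero fun k _ => by rw [← scaleHom_coeff, hf, Polynomial.coeff_zero]
  have hab : scaleHom σ K a * scaleHom σ K b = Polynomial.monomial n (a * b) := by
    rw [← map_mul]
    ext1 k
    rw [scaleHom_coeff, homogeneousComponent_of_mem hp, Polynomial.coeff_monomial]
    simp [eq_comm]
  have ha : scaleHom σ K a ≠ 0 := (map_ne_zero_iff _ hinj).mpr ha0
  have hb : scaleHom σ K b ≠ 0 := (map_ne_zero_iff _ hinj).mpr (right_ne_zero_of_mul h0)
  have h1 := Polynomial.natDegree_mul ha hb
  have h2 := Polynomial.natTrailingDegree_mul ha hb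
  rw [hab, Polynomial.natDegree_monomial_eq _ h0] at h1
  rw [hab, Polynomial.natTrailingDegree_monomial h0] at h2
  have h3 := Polynomial.natTrailingDegree_le_natDegree (scaleHom σ K a)
  have h4 := Polynomial.natTrailingDegree_le_natDegree (scaleHom σ K b)
  have h5 : (scaleHom σ K a).natTrailingDegree = (scaleHom σ K a).natDegree := by omega
  suffices H : a = homogeneousComponent (scaleHom σ K a).natDegree a by
    have hh : a.IsHomogeneous (scaleHom σ K a).natDegree := by
      have := homogeneousComponent_isHomogeneous (scaleHom σ K a).natDegree a
      rwa [← H] at this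
    rwa [← hh.totalDegree ha0] at hh
  have key : ∀ k ≠ (scaleHom σ K a).natDegree, homogeneousComponent k a = 0 := by
    intro k hk
    rw [← scaleHom_coeff]
    rcases lt_or_gt_of_ne hk with hk | hk
    · exact Polynomial.coeff_eq_zero_of_lt_natTrailingDegree (by omega)
    · exact Polynomial.coeff_eq_zero_of_natDegree_lt hk
  conv_lhs => rw [← sum_homogeneousComponent a]
  refine Finset.sum_eq_single _ (fun k _ hk => key k hk) fun hk => ?_
  exact homogeneousComponent_eq_zero _ _ (by simpa using hk)

/-- The quotient of a form by a divisor of at least the same degree is constant. -/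
theorem exists_eq_C_mul_of_dvd {σ : Type*} {q p : MvPolynomial σ K} (h : q ∣ p)
    (hd : p.totalDegree ≤ q.totalDegree) : ∃ c : K, p = C c * q := by
  obtain ⟨b, rfl⟩ := h
  by_cases h0 : q * b = 0
  · exact ⟨0, by simp [h0]⟩
  rw [totalDegree_mul_of_isDomain (left_ne_zero_of_mul h0) (right_ne_zero_of_mul h0)] at hd
  have hb : b.totalDegree = 0 := by omega
  exact ⟨coeff 0 b, by rw [mul_comm, ← totalDegree_eq_zero_iff_eq_C.mp hb]⟩

theorem not_isUnit_of_eval_eq_zero {σ : Type*} {f : MvPolynomial σ K} {a : σ → K}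
    (h : eval a f = 0) : ¬ IsUnit f := fun hf => by
  have := hf.map (eval a)
  rw [h] at this
  exact not_isUnit_zero this

/-- Modulo the linear form, `a i * X j = X i * a j` for all `j`, so homogeneity gives `a i ^ n * f =
X i ^ n * f(a) = 0`, and some `a i` is invertible. -/
theorem linear_dvd_of_eval_eq_zero {f : MvPolynomial (Fin 2) K} {n : ℕ}
    (hf : f.IsHomogeneous n) {a : Fin 2 → K} (ha : a ≠ 0) (h : eval a f = 0) :
    (C (a 1) * X 0 - C (a 0) * X 1 : MvPolynomial (Fin 2) K) ∣ f := by
  rw [← Ideal.Quotient.eq_zero_iff_dvd]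
  set I := Ideal.span {(C (a 1) * X 0 - C (a 0) * X 1 : MvPolynomial (Fin 2) K)}
  set π := Ideal.Quotient.mkₐ K I
  have hrel : π (C (a 1)) * π (X 0) = π (C (a 0)) * π (X 1) := by
    rw [← map_mul, ← map_mul, ← sub_eq_zero, ← map_sub]
    exact Ideal.Quotient.eq_zero_iff_mem.mpr (Ideal.mem_span_singleton_self _)
  have hπ : ∀ g : MvPolynomial (Fin 2) K, aeval (fun i => π (X i)) g = π g := by
    intro g
    have : aeval (fun i => π (X i)) = π := by ext i; simp
    rw [this]
  obtain ⟨i, hi⟩ : ∃ i, a i ≠ 0 := by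
    by_contra hc; push Not at hc; exact ha (funext hc)
  have h1 : ∀ j, π (C (a i)) * π (X j) = π (X i) * π (C (a j)) := by
    intro j
    fin_cases i <;> fin_cases j
    · exact mul_comm _ _
    · exact hrel.symm.trans (mul_comm _ _)
    · exact hrel.trans (mul_comm _ _)
    · exact mul_comm _ _
  have h2 := aeval_smul_of_isHomogeneous hf (π (C (a i))) (fun j => π (X j))
  have h3 := aeval_smul_of_isHomogeneous hf (π (X i)) (fun j => π (C (a j)))
  have h4 : aeval (fun j => π (C (a j))) f = 0 := by
    have : (aeval (fun j => π (C (a j))) : MvPolynomial (Fin 2) K →ₐ[K] _) =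
        (Algebra.ofId K _).comp (aeval a) := by
      ext j; simp [Algebra.ofId_apply]
    rw [this, AlgHom.comp_apply, aeval_eq_eval, h, map_zero]
  rw [funext h1, h3, h4, mul_zero, hπ] at h2
  have hu : IsUnit (π (C (a i)) ^ n) :=
    (((isUnit_iff_ne_zero.mpr hi).map (C : K →+* MvPolynomial (Fin 2) K)).map π).pow n
  exact (hu.mul_right_eq_zero).mp h2.symm

theorem NoCommonFactor.exists_eval_ne_zero {ι : Type*} {w : ι → MvPolynomial (Fin 2) K} {n : ℕ}
    (hw : ∀ i, (w i).IsHomogeneous n) (hc : NoCommonFactor w) {a : Fin 2 → K} (ha : a ≠ 0) :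
    ∃ i, eval a (w i) ≠ 0 := by
  by_contra! h
  refine not_isUnit_of_eval_eq_zero (a := a) ?_
    (hc _ fun i => linear_dvd_of_eval_eq_zero (hw i) ha (h i))
  simp [mul_comm]

/-- A family of polynomials that do not all vanish is a multiple of a family without common
factor. -/
theorem exists_eq_mul_noCommonFactor {σ ι : Type*} {w : ι → MvPolynomial σ K}
    (hw : ∃ i, w i ≠ 0) :
    ∃ (q : MvPolynomial σ K) (w' : ι → MvPolynomial σ K),
      (∀ i, w i = q * w' i) ∧ NoCommonFactor w' := by
  classical
  obtain ⟨i, hi⟩ := hw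
  -- Take `q` to be a common divisor of maximal total degree: any further common factor must then be
  -- constant.
  let S : Set ℕ := {k | ∃ q, (∀ j, q ∣ w j) ∧ q.totalDegree = k}
  have hb : BddAbove S := ⟨(w i).totalDegree, by
    rintro k ⟨q, hq, rfl⟩
    exact totalDegree_le_of_dvd_of_isDomain (hq i) hi⟩
  obtain ⟨q, hq, hqS⟩ := Nat.sSup_mem (s := S) ⟨_, 1, fun j => one_dvd _, rfl⟩ hb
  choose w' hw' using hq
  refine ⟨q, w', hw', fun g hg => ?_⟩
  have hgi : q * g ∣ w i := by rw [hw']; exact mul_dvd_mul_left _ (hg i)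
  have h0 : q * g ≠ 0 := fun h => hi (by simpa [h] using hgi)
  have hmem : (q * g).totalDegree ∈ S :=
    ⟨_, fun j => by rw [hw']; exact mul_dvd_mul_left _ (hg j), rfl⟩
  have hle := le_csSup hb hmem
  rw [totalDegree_mul_of_isDomain (left_ne_zero_of_mul h0) (right_ne_zero_of_mul h0)] at hle
  have hg0 : g.totalDegree = 0 := by omega
  rw [totalDegree_eq_zero_iff_eq_C] at hg0
  rw [hg0]
  refine (isUnit_iff_ne_zero.mpr fun h => right_ne_zero_of_mul h0 ?_).map C
  rw [hg0, h, C_0]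

/-- A family of non-constant forms without common factor does not define a constant map. -/
theorem NoCommonFactor.exists_independent_values [Infinite K] {σ ι : Type*}
    {w : ι → MvPolynomial σ K} {m : ℕ} (hw : ∀ i, (w i).IsHomogeneous m) (hm : 1 ≤ m)
    (hc : NoCommonFactor w) (h0 : ∃ i, w i ≠ 0) :
    ∃ a b i j, eval a (w i) * eval b (w j) ≠ eval a (w j) * eval b (w i) := by
  obtain ⟨i, hi⟩ := h0
  obtain ⟨a, ha⟩ : ∃ a, eval a (w i) ≠ 0 := by
    by_contra! h; exact hi (MvPolynomial.funext (by simpa using h))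
  by_contra! h
  have hdvd : ∀ j, w i ∣ w j := fun j => by
    have : C (eval a (w i)) * w j = C (eval a (w j)) * w i :=
      MvPolynomial.funext fun b => by simpa using h a b i j
    have hu : IsUnit (C (eval a (w i)) : MvPolynomial σ K) := (isUnit_iff_ne_zero.mpr ha).map C
    exact hu.dvd_mul_left.mp (this ▸ dvd_mul_left _ _)
  have hu := hc _ hdvd
  have : eval 0 (w i) = 0 := by
    have := aeval_smul_of_isHomogeneous (hw i) (0 : K) (0 : σ → K)
    simp only [zero_mul, zero_pow (by omega : m ≠ 0), aeval_eq_eval] at this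
    exact this
  exact not_isUnit_of_eval_eq_zero this hu

end Forms

/-! ### The ideal of a parameterized curve and the closure of its image. -/

section Parameterization

variable {K : Type*} [Field K]

theorem aeval_mul_eq_zero_iff {σ A : Type*} [CommRing A] [IsDomain A] [Algebra K A]
    {f : MvPolynomial σ K} {n : ℕ} (hf : f.IsHomogeneous n) {q : A} (hq : q ≠ 0) {w w' : σ → A}
    (hw : ∀ i, w i = q * w' i) : aeval w f = 0 ↔ aeval w' f = 0 := by
  rw [funext hw, aeval_smul_of_isHomogeneous hf]
  simp [hq]

/-- The forms that vanish on a non-constant curve in the plane given by a parameterization are the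
multiples of any irreducible polynomial among them. -/
theorem dvd_of_aeval_eq_zero {w : Fin 3 → MvPolynomial (Fin 2) K} {m : ℕ}
    (hw : ∀ i, (w i).IsHomogeneous m) (hm : 1 ≤ m)
    (hne : ∃ a b i j, eval a (w i) * eval b (w j) ≠ eval a (w j) * eval b (w i))
    {G : MvPolynomial (Fin 3) K} (hG : Irreducible G) (hGw : aeval w G = 0)
    {f : MvPolynomial (Fin 3) K} (hf : aeval w f = 0) : G ∣ f := by
  obtain ⟨a, b, i, j, hab⟩ := hne
  by_contra hdvd
  -- `ρ` restricts binary forms to the line through the origin and `a`; composed with `w`, it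
  -- parameterizes the line spanned by `w(a)` in affine 3-space.
  let ρ : MvPolynomial (Fin 2) K →ₐ[K] Polynomial K :=
    aeval fun k => Polynomial.X * Polynomial.C (a k)
  have hC : ∀ g : MvPolynomial (Fin 2) K,
      aeval (fun k => Polynomial.C (a k)) g = Polynomial.C (eval a g) := by
    intro g
    have : (aeval fun k => Polynomial.C (a k)) =
        (Algebra.ofId K (Polynomial K)).comp (aeval a) := by
      ext k; simp [Algebra.ofId_apply]
    rw [this, AlgHom.comp_apply, aeval_eq_eval]; rfl
  have hρ : ∀ k, ρ (w k) = Polynomial.X ^ m * Polynomial.C (eval a (w k)) := fun k => by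
    simp only [ρ]
    rw [aeval_smul_of_isHomogeneous (hw k), hC]
  let φ₁ : MvPolynomial (Fin 3) K →ₐ[K] Polynomial K := ρ.comp (aeval w)
  let φ₂ : MvPolynomial (Fin 3) K →ₐ[K] K := (Polynomial.aeval (0 : K)).comp φ₁
  -- If `G` did not divide `f`, there would be a strict chain of irreducible closed sets: affine
  -- 3-space, the cone `G = 0`, the closure of the image of `w`, the line through `w(a)`, the
  -- origin. Its length 4 exceeds the dimension 3. Independence of the values at `a` and `b` makes
  -- the last two inclusions strict.
  let p₀ : PrimeSpectrum (MvPolynomial (Fin 3) K) := ⟨⊥, Ideal.isPrime_bot⟩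
  let p₁ : PrimeSpectrum (MvPolynomial (Fin 3) K) :=
    ⟨Ideal.span {G}, (Ideal.span_singleton_prime hG.ne_zero).mpr hG.prime⟩
  let p₂ : PrimeSpectrum (MvPolynomial (Fin 3) K) := ⟨RingHom.ker (aeval w : _ →ₐ[K] _),
    RingHom.ker_isPrime _⟩
  let p₃ : PrimeSpectrum (MvPolynomial (Fin 3) K) := ⟨RingHom.ker φ₁, RingHom.ker_isPrime _⟩
  let p₄ : PrimeSpectrum (MvPolynomial (Fin 3) K) := ⟨RingHom.ker φ₂, RingHom.ker_isPrime _⟩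
  have h01 : p₀ < p₁ := by
    refine lt_of_le_of_ne (bot_le (a := Ideal.span {G})) fun h => hG.ne_zero ?_
    have := congrArg PrimeSpectrum.asIdeal h
    exact Ideal.span_singleton_eq_bot.mp this.symm
  have h12 : p₁ < p₂ := by
    refine lt_of_le_of_ne ((Ideal.span_singleton_le_iff_mem _).mpr hGw) fun h => hdvd ?_
    have := congrArg PrimeSpectrum.asIdeal h
    have hf' : f ∈ p₂.asIdeal := RingHom.mem_ker.mpr hf
    rw [← this] at hf'
    exact Ideal.mem_span_singleton.mp hf'
  have h23 : p₂ < p₃ := by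
    refine lt_of_le_of_ne (fun g (hg : aeval w g = 0) => ?_) fun h => hab ?_
    · change ρ (aeval w g) = 0
      rw [hg, map_zero]
    · have h1 : (C (eval a (w i)) * X j - C (eval a (w j)) * X i : MvPolynomial (Fin 3) K)
          ∈ p₃.asIdeal := by
        change ρ (aeval w _) = 0
        simp only [map_sub, map_mul, aeval_X, algHom_C, hρ, algebraMap_eq]
        simp only [Polynomial.algebraMap_eq]
        ring
      rw [← h] at h1
      have h2 : aeval w (C (eval a (w i)) * X j - C (eval a (w j)) * X i :
        MvPolynomial (Fin 3) K) = 0 := h1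
      have h3 := congrArg (eval b) h2
      simpa [sub_eq_zero] using h3
  have h34 : p₃ < p₄ := by
    refine lt_of_le_of_ne (fun g (hg : φ₁ g = 0) => ?_) fun h => hab ?_
    · change Polynomial.aeval (0 : K) (φ₁ g) = 0
      rw [hg, map_zero]
    · have h1 : ∀ k, eval a (w k) = 0 := fun k => by
        have h2 : (X k : MvPolynomial (Fin 3) K) ∈ p₄.asIdeal := by
          change Polynomial.aeval (0 : K) (ρ (aeval w (X k))) = 0
          rw [aeval_X, hρ]
          simp
          exact Or.inr (by omega)
        rw [← h] at h2
        have h3 : ρ (aeval w (X k)) = 0 := h2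
        rw [aeval_X, hρ] at h3
        exact Polynomial.C_eq_zero.mp ((mul_eq_zero.mp h3).resolve_left
          (pow_ne_zero _ Polynomial.X_ne_zero))
      rw [h1, h1]; simp
  let s : LTSeries (PrimeSpectrum (MvPolynomial (Fin 3) K)) :=
    { length := 4
      toFun := ![p₀, p₁, p₂, p₃, p₄]
      step := fun k => by
        fin_cases k
        exacts [h01, h12, h23, h34] }
  have hs : ((4 : ℕ) : WithBot ℕ∞) ≤ ringKrullDim (MvPolynomial (Fin 3) K) :=
    Order.LTSeries.length_le_krullDim s
  rw [MvPolynomial.ringKrullDim_of_isNoetherianRing, ringKrullDim_eq_zero_of_field] at hs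
  simp only [Nat.card_eq_fintype_card, Fintype.card_fin, zero_add] at hs
  exact absurd (Nat.cast_le.mp hs) (by norm_num)

theorem dvd_iff_aeval_eq_zero {w : Fin 3 → MvPolynomial (Fin 2) K} {m : ℕ}
    (hw : ∀ i, (w i).IsHomogeneous m) (hm : 1 ≤ m)
    (hne : ∃ a b i j, eval a (w i) * eval b (w j) ≠ eval a (w j) * eval b (w i))
    {G : MvPolynomial (Fin 3) K} (hG : Irreducible G) (hGw : aeval w G = 0)
    {f : MvPolynomial (Fin 3) K} : G ∣ f ↔ aeval w f = 0 :=
  ⟨fun ⟨g, hg⟩ => by rw [hg, map_mul, hGw, zero_mul],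
    dvd_of_aeval_eq_zero hw hm hne hG hGw⟩

theorem eval_aeval {σ τ : Type*} (w : σ → MvPolynomial τ K) (a : τ → K) (f : MvPolynomial σ K) :
    eval a (aeval w f) = eval (fun i => eval a (w i)) f := by
  have : (aeval a).comp (aeval w) = aeval (fun i => eval a (w i)) := by
    ext i; simp
  simpa using DFunLike.congr_fun this f

theorem vanishesAt_image_iff [Infinite K] (C₀ : PlaneCurve K) (Λ : PlaneRationalMap K)
    {u w : Fin 3 → MvPolynomial (Fin 2) K} {q : MvPolynomial (Fin 2) K} (hd : Λ.degree ≠ 0)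
    (hu : ∀ f : MvPolynomial (Fin 3) K, C₀.poly ∣ f ↔ aeval u f = 0)
    (hq : ∀ i, aeval u (Λ.form i) = q * w i) (hΛ : ∃ i, aeval u (Λ.form i) ≠ 0)
    {n : ℕ} {f : MvPolynomial (Fin 3) K} (hf : f.IsHomogeneous n) :
    (∀ y ∈ Λ.image C₀.points, VanishesAt f y) ↔ aeval w f = 0 := by
  obtain ⟨i, hi⟩ := hΛ
  have hq0 : q ≠ 0 := fun h => hi (by rw [hq, h, zero_mul])
  rw [← aeval_mul_eq_zero_iff hf hq0 hq]
  constructor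
  · intro H
    -- The extra factor disposes of the parameters at which the chosen form of `Λ` vanishes; at all
    -- others `Λ` is defined.
    suffices h : aeval (fun i => aeval u (Λ.form i)) f * aeval u (Λ.form i) = 0 from
      (mul_eq_zero.mp h).resolve_right hi
    refine MvPolynomial.funext fun z => ?_
    rw [map_mul, eval_aeval, map_zero]
    by_cases hz : eval z (aeval u (Λ.form i)) = 0
    · rw [hz, mul_zero]
    rw [eval_aeval] at hz
    set v : Fin 3 → K := fun j => eval z (u j) with hv
    have hev : ∀ j, eval z (aeval u (Λ.form j)) = eval v (Λ.form j) := fun j => eval_aeval _ _ _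
    have hv0 : v ≠ 0 := fun h => hz (by
      have := aeval_smul_of_isHomogeneous (Λ.homogeneous i) (0 : K) v
      rw [zero_pow hd] at this
      simpa [h] using this)
    obtain ⟨c, hc⟩ := Projectivization.exists_smul_eq_mk_rep K v hv0
    have hrep : ∀ j, eval (Projectivization.mk K v hv0).rep (Λ.form j)
        = (c : K) ^ Λ.degree * eval v (Λ.form j) := fun j => by
      rw [← hc]
      exact aeval_smul_of_isHomogeneous (Λ.homogeneous j) (c : K) v
    have hne : (fun j => eval (Projectivization.mk K v hv0).rep (Λ.form j)) ≠ 0 := fun h => by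
      have := congrFun h i
      simp only [hrep, Pi.zero_apply] at this
      exact hz ((mul_eq_zero.mp this).resolve_left (pow_ne_zero _ c.ne_zero))
    have hmem : Projectivization.mk K v hv0 ∈ C₀.points :=
      (vanishesAt_mk_iff C₀.homogeneous v hv0).mpr (by
        rw [hv, ← eval_aeval, (hu _).mp dvd_rfl, map_zero])
    have := (vanishesAt_mk_iff hf _ hne).mp (H _ ⟨_, hmem, hne, rfl⟩)
    rw [funext hrep] at this
    have h2 := aeval_smul_of_isHomogeneous hf ((c : K) ^ Λ.degree)
      (fun j => eval v (Λ.form j))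
    simp only [aeval_eq_eval] at h2
    rw [h2] at this
    rw [funext hev, (mul_eq_zero.mp this).resolve_left (pow_ne_zero _ (pow_ne_zero _ c.ne_zero)),
      zero_mul]
  · rintro H y ⟨p, hp, h, rfl⟩
    rw [vanishesAt_mk_iff hf]
    -- The pull-back of `f` vanishes along `u`, hence is divisible by the equation of `C₀`. This
    -- covers every point of `C₀` without showing that `u` reaches it.
    have h1 : aeval u (aeval Λ.form f) = 0 := by
      have : (aeval u).comp (aeval Λ.form) = aeval (fun i => aeval u (Λ.form i)) := by
        ext i; simp
      rw [← H, ← this]; rfl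
    obtain ⟨g, hg⟩ := (hu _).mpr h1
    rw [← eval_aeval, hg, map_mul]
    have : eval p.rep C₀.poly = 0 := hp
    rw [this, zero_mul]

/-- The closure of the image of a parameterized curve is the curve whose equation vanishes on the
image of the parameterization. -/
theorem points_eq_zariskiClosure_iff [Infinite K] (C₀ C : PlaneCurve K) (Λ : PlaneRationalMap K)
    {u w : Fin 3 → MvPolynomial (Fin 2) K} {q : MvPolynomial (Fin 2) K} (hd : Λ.degree ≠ 0)
    (hu : ∀ f : MvPolynomial (Fin 3) K, C₀.poly ∣ f ↔ aeval u f = 0)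
    (hq : ∀ i, aeval u (Λ.form i) = q * w i) (hΛ : ∃ i, aeval u (Λ.form i) ≠ 0)
    {m : ℕ} (hw : ∀ i, (w i).IsHomogeneous m) (hm : 1 ≤ m)
    (hne : ∃ a b i j, eval a (w i) * eval b (w j) ≠ eval a (w j) * eval b (w i)) :
    C.points = zariskiClosure (Λ.image C₀.points) ↔ aeval w C.poly = 0 := by
  have key : ∀ (n : ℕ) (f : MvPolynomial (Fin 3) K), f.IsHomogeneous n →
      ((∀ y ∈ Λ.image C₀.points, VanishesAt f y) ↔ aeval w f = 0) :=
    fun n f hf => vanishesAt_image_iff C₀ Λ hd hu hq hΛ hf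
  constructor
  · intro h
    rw [← key _ _ C.homogeneous]
    intro y hy
    have : y ∈ C.points := by
      rw [h]
      exact fun n f _ hf => hf y hy
    exact this
  · intro h
    ext p
    constructor
    · intro hp n f hf hfy
      obtain ⟨g, rfl⟩ := dvd_of_aeval_eq_zero hw hm hne C.irreducible h ((key n f hf).mp hfy)
      have : eval p.rep C.poly = 0 := hp
      rw [VanishesAt, map_mul, this, zero_mul]
    · intro hp
      exact hp _ _ C.homogeneous ((key _ _ C.homogeneous).mpr h)

end Parameterization

/-! ### A birational parameterization has degree at most that of the curve. -/

section DegreeOfParameterization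

variable {K : Type*} [Field K]

/-- Setting the second variable of a binary form equal to `1`. -/
noncomputable def dehom (K : Type*) [Field K] : MvPolynomial (Fin 2) K →ₐ[K] Polynomial K :=
  aeval ![Polynomial.X, 1]

theorem eval_dehom (g : MvPolynomial (Fin 2) K) (a : K) :
    (dehom K g).eval a = eval ![a, 1] g := by
  have : (Polynomial.aeval a).comp (dehom K) = aeval ![a, 1] := by
    ext i; fin_cases i <;> simp [dehom]
  simpa using DFunLike.congr_fun this g

/-- The value at the point at infinity `(1 : 0)` is the top coefficient, so a form non-zero there
loses no degree on setting `X 1 = 1`. -/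
theorem coeff_dehom {g : MvPolynomial (Fin 2) K} {m : ℕ} (hg : g.IsHomogeneous m) :
    (dehom K g).coeff m = eval ![1, 0] g := by
  rw [dehom, aeval_def, eval₂_eq', eval_eq', Polynomial.finsetSum_coeff]
  refine Finset.sum_congr rfl fun d hd => ?_
  have hdeg : d 0 + d 1 = m := by
    have := hg.degree_eq_sum_deg_support hd
    rw [← Finsupp.degree_apply, Finsupp.degree_eq_sum] at this
    simpa using this.symm
  simp only [Fin.prod_univ_two, Matrix.cons_val_zero, Matrix.cons_val_one, one_pow, mul_one,
    one_mul, Polynomial.algebraMap_apply, Algebra.algebraMap_self, RingHom.id_apply,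
    Polynomial.coeff_C_mul, Polynomial.coeff_X_pow]
  by_cases h : d 1 = 0
  · simp [h, (by omega : m = d 0)]
  · rw [if_neg (by omega), zero_pow h, mul_zero]

theorem dehom_ne_zero [Infinite K] {g : MvPolynomial (Fin 2) K} {m : ℕ} (hg : g.IsHomogeneous m)
    (h0 : g ≠ 0) : dehom K g ≠ 0 := by
  intro h
  -- Multiplying by `X 1` leaves only points off `X 1 = 0` to be checked, and these rescale to the
  -- chart.
  suffices g * X 1 = 0 from (mul_eq_zero.mp this).elim h0 (X_ne_zero 1)
  refine MvPolynomial.funext fun a => ?_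
  by_cases ha : a 1 = 0
  · simp [ha]
  have h1 := aeval_smul_of_isHomogeneous hg (a 1) ![a 0 / a 1, 1]
  have h2 : (fun i => a 1 * (![a 0 / a 1, 1] : Fin 2 → K) i) = a := by
    funext i; fin_cases i <;> simp; field_simp
  rw [h2, aeval_eq_eval, aeval_eq_eval, ← eval_dehom, h] at h1
  rw [map_mul]
  simpa using Or.inl h1

/-- A general linear combination of two members of a base-point free triple of binary forms has no
common zero with the third one. -/
theorem exists_generic_combination [Infinite K] {f g h : MvPolynomial (Fin 2) K} {m : ℕ}
    (hf : f.IsHomogeneous m) (hf0 : f ≠ 0)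
    (hc : ∀ a : Fin 2 → K, a ≠ 0 → eval a f ≠ 0 ∨ eval a g ≠ 0 ∨ eval a h ≠ 0) :
    ∃ c : K, (∀ a : K, eval ![a, 1] f ≠ 0 ∨ eval ![a, 1] (g + C c * h) ≠ 0) ∧
      (eval ![1, 0] f ≠ 0 ∨ eval ![1, 0] (g + C c * h) ≠ 0) := by
  classical
  -- Each zero of `f` excludes at most one value of `c`; the inserted element accounts for infinity.
  -- Where `h` vanishes the quotient is a junk value, but there no `c` needs to be excluded.
  let S : Finset K := insert (-eval ![1, 0] g / eval ![1, 0] h)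
    ((dehom K f).roots.toFinset.image fun a => -eval ![a, 1] g / eval ![a, 1] h)
  obtain ⟨c, hcS⟩ := Infinite.exists_notMem_finset S
  have key : ∀ a : Fin 2 → K, a ≠ 0 → eval a f = 0 → -eval a g / eval a h ≠ c →
      eval a (g + C c * h) ≠ 0 := by
    intro a ha hfa hne h0
    simp only [map_add, map_mul, eval_C] at h0
    have hh : eval a h ≠ 0 := fun hh => by
      rcases hc a ha with h1 | h1 | h1
      · exact h1 hfa
      · exact h1 (by simpa [hh] using h0)
      · exact h1 hh
    refine hne ?_
    rw [div_eq_iff hh]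
    linear_combination -h0
  refine ⟨c, fun a => ?_, ?_⟩
  · by_contra! hcon
    refine key _ (fun h => by simpa using congrFun h 1) hcon.1 (fun h => hcS ?_) hcon.2
    refine Finset.mem_insert_of_mem (Finset.mem_image.mpr ⟨a, ?_, h⟩)
    rw [Multiset.mem_toFinset, Polynomial.mem_roots (dehom_ne_zero hf hf0), Polynomial.IsRoot.def,
      eval_dehom]
    exact hcon.1
  · by_contra! hcon
    refine key _ (fun h => by simpa using congrFun h 0) hcon.1 (fun h => hcS ?_) hcon.2
    rw [← h]
    exact Finset.mem_insert_self _ _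

theorem fin_three_cases : ∀ i k : Fin 3, k = i ∨ k = i + 1 ∨ k = i + 2 := by decide

/-- The vector with entry `x` at `i`, `z` at `i + 2`, and `1 - c z` at `i + 1`. -/
def chartVector {A : Type*} [CommRing A] (i : Fin 3) (c x z : A) : Fin 3 → A := fun k =>
  if k = i then x else if k = i + 1 then 1 - c * z else z

theorem eq_chartVector {A : Type*} [CommRing A] {i : Fin 3} {c : A} {y : Fin 3 → A}
    (h : y (i + 1) + c * y (i + 2) = 1) : y = chartVector i c (y i) (y (i + 2)) := by
  have h1 : ∀ i : Fin 3, i + 1 ≠ i ∧ i + 2 ≠ i ∧ i + 2 ≠ i + 1 := by decide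
  funext k
  rcases fin_three_cases i k with rfl | rfl | rfl
  · simp [chartVector]
  · simp [chartVector, ← h]
  · simp [chartVector, h1]

theorem map_chartVector {A B : Type*} [CommRing A] [CommRing B] (φ : A →+* B) (i : Fin 3)
    (c x z : A) (k : Fin 3) : φ (chartVector i c x z k) = chartVector i (φ c) (φ x) (φ z) k := by
  unfold chartVector
  split_ifs <;> simp

theorem exists_eval_chartVector_ne_zero [Infinite K] {G : MvPolynomial (Fin 3) K} {D : ℕ}
    (hG : G.IsHomogeneous D) (hG0 : G ≠ 0) (i : Fin 3) (c : K) :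
    ∃ x z : K, eval (chartVector i c x z) G ≠ 0 := by
  by_contra! h
  have hl : (X (i + 1) + C c * X (i + 2) : MvPolynomial (Fin 3) K) ≠ 0 := fun h0 => by
    have := congrArg (eval (Pi.single (i + 1) 1)) h0
    have h1 : ∀ i : Fin 3, i + 2 ≠ i + 1 := by decide
    simp [h1] at this
  suffices G * (X (i + 1) + C c * X (i + 2)) = 0 from (mul_eq_zero.mp this).elim hG0 hl
  refine MvPolynomial.funext fun a => ?_
  set s := a (i + 1) + c * a (i + 2) with hs
  by_cases h0 : s = 0
  · simp [← hs, h0]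
  have h1 := aeval_smul_of_isHomogeneous hG s (fun k => s⁻¹ * a k)
  have h2 : (fun k => s⁻¹ * a k) = chartVector i c (s⁻¹ * a i) (s⁻¹ * a (i + 2)) :=
    eq_chartVector (by field_simp; exact hs.symm)
  simp only [aeval_eq_eval] at h1
  rw [h2, h, mul_zero] at h1
  have h3 : (fun k => s * (s⁻¹ * a k)) = a := by
    funext k; field_simp
  rw [h3] at h1
  rw [map_mul]
  simpa using Or.inl h1

open IntermediateField in
/-- If the curve given by a base-point free triple of binary forms of degree `m` lies on `V(G)` and
the parameterization has a rational inverse `(R₀ : R₁)`, then `m ≤ deg G`. -/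
theorem degree_le_of_birational_parameterization [IsAlgClosed K]
    {w : Fin 3 → MvPolynomial (Fin 2) K} {m : ℕ} (hw : ∀ i, (w i).IsHomogeneous m)
    (hc : NoCommonFactor w) {G : MvPolynomial (Fin 3) K} {D : ℕ} (hG : G.IsHomogeneous D)
    (hG0 : G ≠ 0) (hGw : aeval w G = 0) {R₀ R₁ : MvPolynomial (Fin 3) K} {k : ℕ}
    (hR₀ : R₀.IsHomogeneous k) (hR₁ : R₁.IsHomogeneous k)
    (hR : X 1 * aeval w R₀ = X 0 * aeval w R₁) (hR0 : aeval w R₁ ≠ 0) : m ≤ D := by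
  have hz : ∀ a : Fin 2 → K, a ≠ 0 → ∃ i, eval a (w i) ≠ 0 := fun a ha =>
    hc.exists_eval_ne_zero hw ha
  obtain ⟨i, hi⟩ : ∃ i, w i ≠ 0 := by
    obtain ⟨i, hi⟩ := hz ![1, 0] (fun h => by simpa using congrFun h 0)
    exact ⟨i, fun h => hi (by rw [h, map_zero])⟩
  rcases Nat.eq_zero_or_pos m with rfl | hm
  · exact Nat.zero_le _
  obtain ⟨c, hc1, hc2⟩ := exists_generic_combination (f := w i) (g := w (i + 1)) (h := w (i + 2))
    (hw i) hi (fun a ha => by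
      obtain ⟨j, hj⟩ := hz a ha
      rcases fin_three_cases i j with rfl | rfl | rfl
      · exact Or.inl hj
      · exact Or.inr (Or.inl hj)
      · exact Or.inr (Or.inr hj))
  set g := w (i + 1) + C c * w (i + 2) with hg
  have hgh : g.IsHomogeneous m := (hw _).add ((hw _).C_mul _)
  set p := dehom K (w i) with hp
  set r := dehom K g with hr
  have hcop : IsCoprime p r := by
    rw [Polynomial.isCoprime_iff_aeval_ne_zero_of_isAlgClosed K K]
    intro a
    simp only [Polynomial.coe_aeval_eq_eval, hp, hr, eval_dehom]
    exact hc1 a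
  -- Since `w i` and `g` have no common zero at infinity, one of them keeps degree `m` in the chart.
  have hdeg : m ≤ max p.natDegree r.natDegree := by
    rw [← coeff_dehom (hw i), ← coeff_dehom hgh] at hc2
    rcases hc2 with h | h
    · exact le_max_of_le_left (Polynomial.le_natDegree_of_ne_zero h)
    · exact le_max_of_le_right (Polynomial.le_natDegree_of_ne_zero h)
  have hr0 : r ≠ 0 := by
    intro h
    rw [h, isCoprime_zero_right] at hcop
    rw [h, Polynomial.natDegree_eq_zero_of_isUnit hcop] at hdeg
    simp at hdeg
    omega
  let ι : Polynomial K →ₐ[K] RatFunc K := Algebra.algHom K (Polynomial K) (RatFunc K)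
  have hι : Function.Injective ι := RatFunc.algebraMap_injective K
  have hιr : ι r ≠ 0 := (map_ne_zero_iff _ hι).mpr hr0
  let f : RatFunc K := ι p / ι r
  have hfeq : f.num * r = p * f.denom := (RatFunc.num_mul_eq_mul_denom_iff hr0).mpr rfl
  have hf0 : f.num ≠ 0 := fun h => by
    rw [h, zero_mul] at hfeq
    exact mul_ne_zero (dehom_ne_zero (hw i) hi) f.denom_ne_zero hfeq.symm
  -- Coprimality of `p` and `r` prevents cancellation in `f = p / r`, so `f` has degree at least `m`
  -- as a rational function.
  have hmax : m ≤ max f.num.natDegree f.denom.natDegree := by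
    refine hdeg.trans (max_le_max ?_ ?_)
    · exact Polynomial.natDegree_le_of_dvd
        (hcop.dvd_of_dvd_mul_right (hfeq ▸ dvd_mul_right p f.denom)) hf0
    · exact Polynomial.natDegree_le_of_dvd
        (hcop.symm.dvd_of_dvd_mul_left (hfeq ▸ dvd_mul_left r f.num)) f.denom_ne_zero
  have hft : Transcendental K f := by
    refine f.transcendental_of_ne_C fun h => ?_
    rw [RatFunc.eq_C_iff] at h
    rw [h.1, h.2] at hmax
    simp at hmax
    omega
  -- The maximum is the degree of `K(t)` over `K(f)`. It is bounded below by `D`, by showing that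
  -- one element of degree at most `D` generates the extension.
  rw [← RatFunc.finrank_eq_max_natDegree] at hmax
  refine hmax.trans ?_
  let y : Fin 3 → RatFunc K := fun j => (ι r)⁻¹ * ι (dehom K (w j))
  have hyf : y i = f := by simp only [y, f]; rw [div_eq_inv_mul]
  have hyc : y (i + 1) + algebraMap K _ c * y (i + 2) = 1 := by
    have : ι r = ι (dehom K (w (i + 1))) + algebraMap K _ c * ι (dehom K (w (i + 2))) := by
      rw [hr, hg, map_add, map_add, map_mul, map_mul, algHom_C,
        AlgHom.commutes]
    simp only [y]
    field_simp
    exact this.symm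
  have hyP : ∀ {P : MvPolynomial (Fin 3) K} {e : ℕ}, P.IsHomogeneous e →
      aeval y P = (ι r)⁻¹ ^ e * ι (dehom K (aeval w P)) := by
    intro P e hP
    simp only [y]
    rw [aeval_smul_of_isHomogeneous hP]
    have : (ι.comp (dehom K)).comp (aeval w) = aeval fun j => ι (dehom K (w j)) := by
      ext j; simp
    rw [← this]; rfl
  have hyG : aeval y G = 0 := by rw [hyP hG, hGw, map_zero, map_zero, mul_zero]
  have hyv := eq_chartVector hyc
  let F : IntermediateField K (RatFunc K) := K⟮f⟯
  let f' : F := ⟨f, mem_adjoin_simple_self K f⟩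
  let v : Fin 3 → Polynomial F :=
    chartVector i (Polynomial.C (algebraMap K F c)) (Polynomial.C f') Polynomial.X
  -- This is the equation of the curve in the chart, with the coordinate `y i` frozen at `f` and `y
  -- (i + 2)` as the unknown.
  let Γ : Polynomial F := aeval v G
  have hΓdeg : Γ.natDegree ≤ D := by
    have h1 : Γ = aeval v (map (algebraMap K F) G) := by
      rw [aeval_map_algebraMap]
    rw [h1, ← mul_one D]
    refine aeval_natDegree_le _ ?_ _ fun j => ?_
    · exact (hG.map _).totalDegree_le
    · simp only [v, chartVector]
      split_ifs
      · simp
      · refine (Polynomial.natDegree_sub_le _ _).trans ?_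
        simpa using Polynomial.natDegree_C_mul_le (algebraMap K F c) Polynomial.X
      · simp
  have hΓroot : Polynomial.aeval (y (i + 2)) Γ = 0 := by
    have h1 : ((Polynomial.aeval (R := F) (y (i + 2))).restrictScalars K).comp (aeval v)
        = aeval y := by
      refine MvPolynomial.algHom_ext fun j => ?_
      simp only [AlgHom.comp_apply, aeval_X, v, AlgHom.restrictScalars_apply]
      have := map_chartVector (Polynomial.aeval (R := F) (y (i + 2))).toRingHom i
        (Polynomial.C (algebraMap K F c)) (Polynomial.C f') Polynomial.X j
      refine this.trans ?_
      conv_rhs => rw [hyv]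
      congr 1
      · simp
      · simp
        rw [hyf]
      · simp
    rw [← hyG, ← h1]; rfl
  -- Were `Γ` zero, specializing its variable to a suitable constant `z` would give a non-trivial
  -- algebraic equation for `f` over `K`.
  have hΓ0 : Γ ≠ 0 := by
    intro h0
    obtain ⟨x, z, hxz⟩ := exists_eval_chartVector_ne_zero hG hG0 i c
    let H : Polynomial K := aeval
      (chartVector i (Polynomial.C c) Polynomial.X (Polynomial.C z)) G
    have hH : H ≠ 0 := by
      intro hH
      apply hxz
      have h1 : (Polynomial.aeval x).comp (aeval
          (chartVector i (Polynomial.C c) Polynomial.X (Polynomial.C z))) =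
          aeval (chartVector i c x z) := by
        refine MvPolynomial.algHom_ext fun j => ?_
        simp only [AlgHom.comp_apply, aeval_X]
        refine (map_chartVector (Polynomial.aeval (R := K) x).toRingHom i
          (Polynomial.C c) Polynomial.X (Polynomial.C z) j).trans ?_
        congr 1 <;> simp
      rw [← aeval_eq_eval, ← h1]
      exact (congrArg (Polynomial.aeval x) hH).trans (map_zero _)
    have h2 : Polynomial.aeval f' H = 0 := by
      have h1 : (Polynomial.aeval f').comp (aeval
          (chartVector i (Polynomial.C c) Polynomial.X (Polynomial.C z))) =
          ((Polynomial.aeval (R := F) (algebraMap K F z)).restrictScalars K).comp (aeval v) := by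
        refine MvPolynomial.algHom_ext fun j => ?_
        simp only [AlgHom.comp_apply, aeval_X, v, AlgHom.restrictScalars_apply]
        refine (map_chartVector (Polynomial.aeval (R := K) f').toRingHom i
          (Polynomial.C c) Polynomial.X (Polynomial.C z) j).trans
          (Eq.trans ?_ (map_chartVector (Polynomial.aeval (R := F) (algebraMap K F z)).toRingHom i
            _ _ _ j).symm)
        congr 1 <;> simp
      have h3 := DFunLike.congr_fun h1 G
      refine h3.trans ?_
      exact (congrArg (Polynomial.aeval (algebraMap K F z)) h0).trans (map_zero _)
    have h4 : Polynomial.aeval f H = 0 := by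
      have := congrArg (algebraMap F (RatFunc K)) h2
      rw [← Polynomial.aeval_algebraMap_apply, map_zero] at this
      exact this
    exact hft ⟨H, hH, h4⟩
  have hint : IsIntegral F (y (i + 2)) := IsAlgebraic.isIntegral ⟨Γ, hΓ0, hΓroot⟩
  -- All chart coordinates lie in this field, and the rational inverse expresses the parameter `t`
  -- as a quotient of polynomials in them.
  have htop : F⟮y (i + 2)⟯ = ⊤ := by
    set S := F⟮y (i + 2)⟯ with hS
    have hK : ∀ a : K, algebraMap K (RatFunc K) a ∈ S := fun a => by
      rw [IsScalarTower.algebraMap_apply K F (RatFunc K)]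
      exact S.algebraMap_mem _
    have hy2 : y (i + 2) ∈ S := mem_adjoin_simple_self F _
    have hyS : ∀ j, y j ∈ S := by
      intro j
      rcases fin_three_cases i j with rfl | rfl | rfl
      · rw [hyf]
        exact S.algebraMap_mem f'
      · have : y (i + 1) = 1 - algebraMap K _ c * y (i + 2) := by linear_combination hyc
        rw [this]
        exact S.sub_mem S.one_mem (S.mul_mem (hK c) hy2)
      · exact hy2
    let T : Subalgebra K (RatFunc K) := S.toSubalgebra.restrictScalars K
    have hRS : ∀ P : MvPolynomial (Fin 3) K, aeval y P ∈ S := by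
      intro P
      have h1 : (aeval y P : RatFunc K) ∈ Algebra.adjoin K (Set.range y) := by
        rw [Algebra.adjoin_range_eq_range_aeval]
        exact ⟨P, rfl⟩
      have h2 : Algebra.adjoin K (Set.range y) ≤ T :=
        Algebra.adjoin_le (by rintro _ ⟨j, rfl⟩; exact hyS j)
      exact h2 h1
    have hX : ι Polynomial.X ∈ S := by
      have h1 : dehom K (aeval w R₁) ≠ 0 := dehom_ne_zero (hR₁.aeval w hw) hR0
      have h2 : ι Polynomial.X * aeval y R₁ = aeval y R₀ := by
        have h3 := congrArg (fun t => ι (dehom K t)) hR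
        simp only [map_mul] at h3
        have h4 : dehom K (X 0) = Polynomial.X := by simp [dehom]
        have h5 : dehom K (X 1) = 1 := by simp [dehom]
        rw [h4, h5, map_one, one_mul] at h3
        rw [hyP hR₀, hyP hR₁, h3]; ring
      have h3 : aeval y R₁ ≠ 0 := by
        rw [hyP hR₁]
        exact mul_ne_zero (pow_ne_zero _ (inv_ne_zero hιr)) ((map_ne_zero_iff _ hι).mpr h1)
      rw [← eq_div_iff h3] at h2
      rw [h2]
      exact S.div_mem (hRS _) (hRS _)
    have hpoly : ∀ P : Polynomial K, ι P ∈ S := by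
      intro P
      have h1 : P ∈ Algebra.adjoin K {(Polynomial.X : Polynomial K)} := by
        rw [Polynomial.adjoin_X]; trivial
      have h2 : Algebra.adjoin K {(Polynomial.X : Polynomial K)} ≤ T.comap ι :=
        Algebra.adjoin_le (by rintro _ rfl; exact hX)
      exact h2 h1
    rw [eq_top_iff]
    intro x _
    rw [← RatFunc.num_div_denom x]
    exact S.div_mem (hpoly _) (hpoly _)
  change Module.finrank F (RatFunc K) ≤ D
  rw [← finrank_top', ← htop, adjoin.finrank hint]
  exact (Polynomial.natDegree_le_natDegree
    (minpoly.degree_le_of_ne_zero F _ hΓ0 hΓroot)).trans hΓdeg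

end DegreeOfParameterization

/-! ### The common factor of three quadrics restricted to the curve. -/

section BaseDegree

variable {K : Type*} [Field K]

/-- The expansion is in powers of `X 2`, around the vertex `(0 : 0 : 1)` of the pencil `(X 0 : X
1)`; `a` is the value of the quadric there. -/
theorem exists_quadratic_coeffs {f : MvPolynomial (Fin 3) K} (hf : f.IsHomogeneous 2) :
    ∃ (a b c : K) (Q : MvPolynomial (Fin 2) K), Q.IsHomogeneous 2 ∧
      f = C a * X 2 ^ 2 + X 2 * (C b * X 0 + C c * X 1) +
        aeval ![(X 0 : MvPolynomial (Fin 3) K), X 1] Q := by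
  rw [← mem_homogeneousSubmodule, ← homogeneousSubmodule_one_pow, pow_two,
    homogeneousSubmodule_one_eq_span_X, Submodule.span_mul_span] at hf
  induction hf using Submodule.span_induction with
  | mem x hx =>
    obtain ⟨_, ⟨i, rfl⟩, _, ⟨j, rfl⟩, rfl⟩ := hx
    have hQ : ∀ i j : Fin 2, (X i * X j : MvPolynomial (Fin 2) K).IsHomogeneous 2 := fun i j =>
      (isHomogeneous_X K i).mul (isHomogeneous_X K j)
    have h0 := isHomogeneous_zero (Fin 2) K 2
    fin_cases i <;> fin_cases j
    · exact ⟨0, 0, 0, _, hQ 0 0, by simp⟩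
    · exact ⟨0, 0, 0, _, hQ 0 1, by simp⟩
    · exact ⟨0, 1, 0, 0, h0, by simp; ring⟩
    · exact ⟨0, 0, 0, _, hQ 1 0, by simp⟩
    · exact ⟨0, 0, 0, _, hQ 1 1, by simp⟩
    · exact ⟨0, 0, 1, 0, h0, by simp; ring⟩
    · exact ⟨0, 1, 0, 0, h0, by simp⟩
    · exact ⟨0, 0, 1, 0, h0, by simp⟩
    · exact ⟨1, 0, 0, 0, h0, by simp; ring⟩
  | zero => exact ⟨0, 0, 0, 0, isHomogeneous_zero _ _ _, by simp⟩
  | add x y _ _ hx hy =>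
    obtain ⟨a, b, c, Q, hQ, rfl⟩ := hx
    obtain ⟨a', b', c', Q', hQ', rfl⟩ := hy
    exact ⟨a + a', b + b', c + c', Q + Q', hQ.add hQ', by simp only [map_add]; ring⟩
  | smul r x _ hx =>
    obtain ⟨a, b, c, Q, hQ, rfl⟩ := hx
    exact ⟨r * a, r * b, r * c, C r * Q, hQ.C_mul r, by
      simp only [map_mul, smul_eq_C_mul, algHom_C, algebraMap_eq]; ring⟩

theorem exists_ne_zero_two_relations (a b : Fin 3 → K) :
    ∃ κ : Fin 3 → K, κ ≠ 0 ∧ ∑ i, κ i * a i = 0 ∧ ∑ i, κ i * b i = 0 := by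
  -- A zero third row makes the system square and visibly singular.
  obtain ⟨κ, h0, hκ⟩ := Matrix.exists_mulVec_eq_zero_iff.mpr
    (show (Matrix.of ![a, b, 0]).det = 0 from Matrix.det_eq_zero_of_row_eq_zero 2 (by simp))
  have h1 := congrFun hκ
  exact ⟨κ, h0, by simpa [Matrix.mulVec, dotProduct, mul_comm] using h1 0,
    by simpa [Matrix.mulVec, dotProduct, mul_comm] using h1 1⟩

/-- The gcd of `v * c` and `u * c` is `c` up to a unit. -/
theorem dvd_mul_of_isRelPrime {R : Type*} [CommRing R] [IsDomain R] [UniqueFactorizationMonoid R]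
    {q v u c : R} (h : IsRelPrime v u) (h1 : q ∣ v * c) (h2 : q ∣ u * c) : q ∣ c := by
  classical
  let := UniqueFactorizationMonoid.toGCDMonoid R
  have h3 := dvd_gcd h1 h2
  have h4 : Associated (gcd (v * c) (u * c)) (gcd v u * c) := gcd_mul_right' c v u
  have h5 : IsUnit (gcd v u) := h (gcd_dvd_left _ _) (gcd_dvd_right _ _)
  exact h5.dvd_mul_left.mp (h4.dvd_iff_dvd_right.mp h3)

/-- Three linearly independent ternary quadratic forms, restricted to the curve
`(X 0 * e : X 1 * e : f)` of degree `n`, have a common factor of degree at most `n + 1`. -/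
theorem totalDegree_le_of_dvd_quadratic {N : Fin 3 → MvPolynomial (Fin 3) K}
    (hN : ∀ i, (N i).IsHomogeneous 2)
    (hind : ∀ κ : Fin 3 → K, ∑ i, C (κ i) * N i = 0 → κ = 0)
    (hdep : ¬ ∀ i, aeval ![(X 0 : MvPolynomial (Fin 3) K), X 1, 0] (N i) = N i)
    {e f q : MvPolynomial (Fin 2) K} {n : ℕ} (hn : 1 ≤ n) (he : e.IsHomogeneous n)
    (hf : f.IsHomogeneous (n + 1)) (he0 : e ≠ 0) (hf0 : f ≠ 0) (hef : IsRelPrime e f)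
    (hq : ∀ i, q ∣ aeval ![X 0 * e, X 1 * e, f] (N i)) : q.totalDegree ≤ n + 2 := by
  choose α b c Q hQ hNQ using fun i => exists_quadratic_coeffs (hN i)
  set l : Fin 3 → MvPolynomial (Fin 2) K := fun i => C (b i) * X 0 + C (c i) * X 1 with hl
  set ι : MvPolynomial (Fin 2) K →ₐ[K] MvPolynomial (Fin 3) K := aeval ![X 0, X 1] with hι
  have hlh : ∀ i, (l i).IsHomogeneous 1 := fun i =>
    (isHomogeneous_C_mul_X _ _).add (isHomogeneous_C_mul_X _ _)
  have hNl : ∀ i, N i = C (α i) * X 2 ^ 2 + X 2 * ι (l i) + ι (Q i) := by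
    intro i
    rw [hNQ i]
    simp [hl, hι]
  have hw : ∀ i, aeval ![X 0 * e, X 1 * e, f] (N i)
      = C (α i) * f ^ 2 + e * (f * l i + e * Q i) := by
    intro i
    have h1 : ∀ p : MvPolynomial (Fin 2) K, aeval ![X 0 * e, X 1 * e, f] (ι p)
        = aeval (fun i => e * X i) p := by
      intro p
      have : (aeval ![X 0 * e, X 1 * e, f]).comp ι = aeval fun i => e * X i := by
        ext i; fin_cases i <;> simp [hι, mul_comm]
      rw [← this]; rfl
    rw [hNl, map_add, map_add, map_mul, map_mul, h1, h1, aeval_smul_of_isHomogeneous (hlh i),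
      aeval_smul_of_isHomogeneous (hQ i), aeval_X_left, AlgHom.id_apply, AlgHom.id_apply]
    simp only [algHom_C, algebraMap_eq, map_pow, aeval_X]
    simp
    ring
  simp only [hw] at hq
  have hcomb : ∀ κ : Fin 3 → K, ∑ i, κ i * α i = 0 → ∑ i, C (κ i) * l i = 0 →
      ∑ i, C (κ i) * Q i = 0 → κ = 0 := by
    intro κ h1 h2 h3
    refine hind κ ?_
    have h1' := congrArg (C : K → MvPolynomial (Fin 3) K) h1
    have h2' := congrArg ι h2
    have h3' := congrArg ι h3
    simp only [Fin.sum_univ_three, map_add, map_mul, map_zero, algHom_C, algebraMap_eq]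
      at h1' h2' h3' ⊢
    rw [hNl, hNl, hNl]
    linear_combination X 2 ^ 2 * h1' + X 2 * h2' + h3'
  -- The case distinction is whether the vertex of the pencil is a common zero of the quadrics.
  by_cases hα : ∀ i, α i = 0
  · simp only [hα, C_0, zero_mul, zero_add] at hq
    have hl0 : ∃ i, l i ≠ 0 := by
      by_contra! h0
      refine hdep fun i => ?_
      have h1 : (aeval ![(X 0 : MvPolynomial (Fin 3) K), X 1, 0]).comp ι = ι := by
        ext i; fin_cases i <;> simp [hι]
      have h2 : N i = ι (Q i) := by rw [hNl, hα, h0]; simp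
      rw [h2]
      exact DFunLike.congr_fun h1 (Q i)
    obtain ⟨i, hi⟩ := hl0
    obtain ⟨κ, hκ0, hκb, hκc⟩ := exists_ne_zero_two_relations b c
    -- Otherwise the pairs `(l j, Q j)` are proportional over the function field, and a constant
    -- relation among the `l j` extends to the `Q j`, hence to the `N j`.
    have hminor : ∃ j k, l j * Q k - l k * Q j ≠ 0 := by
      by_contra! h0
      refine hκ0 (hcomb κ (by simp [hα]) ?_ ?_)
      · have h1 := congrArg (C : K → MvPolynomial (Fin 2) K) hκb
        have h2 := congrArg (C : K → MvPolynomial (Fin 2) K) hκc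
        simp only [Fin.sum_univ_three, map_add, map_mul, map_zero, hl] at h1 h2 ⊢
        linear_combination X 0 * h1 + X 1 * h2
      · refine (mul_eq_zero.mp ?_).resolve_left hi
        have h1 := congrArg (C : K → MvPolynomial (Fin 2) K) hκb
        have h2 := congrArg (C : K → MvPolynomial (Fin 2) K) hκc
        have h3 : ∑ j, C (κ j) * l j = 0 := by
          simp only [Fin.sum_univ_three, map_add, map_mul, map_zero, hl] at h1 h2 ⊢
          linear_combination X 0 * h1 + X 1 * h2
        rw [Fin.sum_univ_three] at h3 ⊢
        linear_combination Q i * h3 + C (κ 0) * h0 i 0 + C (κ 1) * h0 i 1 + C (κ 2) * h0 i 2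
    by_contra! hdeg
    -- Eliminating `Q` and then `l` shows that `q` divides both `e` and `f` times `e * (l j * Q k -
    -- l k * Q j)`. That form has degree `n + 3`, so `q` of degree above `n + 2` leaves only a
    -- constant quotient.
    have hμ : ∀ j k, ∃ d : K, e * (l j * Q k - l k * Q j) = C d * q := by
      intro j k
      refine exists_eq_C_mul_of_dvd ?_ ?_
      · refine dvd_mul_of_isRelPrime hef ?_ ?_
        · have : e * (e * (l j * Q k - l k * Q j)) =
            l j * (e * (f * l k + e * Q k)) - l k * (e * (f * l j + e * Q j)) := by ring
          rw [this]
          exact dvd_sub ((hq k).mul_left _) ((hq j).mul_left _)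
        · have : f * (e * (l j * Q k - l k * Q j)) =
            Q k * (e * (f * l j + e * Q j)) - Q j * (e * (f * l k + e * Q k)) := by ring
          rw [this]
          exact dvd_sub ((hq j).mul_left _) ((hq k).mul_left _)
      · have h1 : (e * (l j * Q k - l k * Q j)).IsHomogeneous (n + (1 + 2)) :=
          he.mul (((hlh j).mul (hQ k)).sub ((hlh k).mul (hQ j)))
        exact h1.totalDegree_le.trans (by omega)
    choose d hd using hμ
    have hq0 : q ≠ 0 := fun h => by simp [h] at hdeg
    -- The determinants with rows `l, l, Q` and `Q, l, Q` vanish. Expanding them turns the constants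
    -- `d` into a linear relation among the `N j`, so all minors vanish.
    have hd0 := hcomb ![d 1 2, d 2 0, d 0 1] (by simp [hα])
      (by
        refine (mul_eq_zero.mp ?_).resolve_left hq0
        simp only [Fin.sum_univ_three, Matrix.cons_val]
        linear_combination -l 0 * hd 1 2 - l 1 * hd 2 0 - l 2 * hd 0 1)
      (by
        refine (mul_eq_zero.mp ?_).resolve_left hq0
        simp only [Fin.sum_univ_three, Matrix.cons_val]
        linear_combination -Q 0 * hd 1 2 - Q 1 * hd 2 0 - Q 2 * hd 0 1)
    have hz : ∀ j k, d j k = 0 → l j * Q k - l k * Q j = 0 := fun j k h => by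
      have h1 := hd j k
      rw [h, C_0, zero_mul] at h1
      exact (mul_eq_zero.mp h1).resolve_left he0
    have h12 := hz 1 2 (congrFun hd0 0)
    have h20 := hz 2 0 (congrFun hd0 1)
    have h01 := hz 0 1 (congrFun hd0 2)
    obtain ⟨j, k, hjk⟩ := hminor
    refine hjk ?_
    fin_cases j <;> fin_cases k <;> simp only [Fin.mk_one, Fin.zero_eta, Fin.reduceFinMk]
    · ring
    · exact h01
    · linear_combination -h20
    · linear_combination -h01
    · ring
    · exact h12
    · exact h20
    · linear_combination -h12
    · ring
  · push Not at hα
    obtain ⟨i, hi⟩ := hα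
    have hqe : IsRelPrime q e := by
      intro g hgq hge
      have h1 : g ∣ C (α i) * f ^ 2 := by
        have := dvd_sub (hgq.trans (hq i)) (hge.mul_right (f * l i + e * Q i))
        simpa using this
      have h2 : g ∣ f ^ 2 :=
        ((isUnit_iff_ne_zero.mpr hi).map (C : K →+* MvPolynomial (Fin 2) K)).dvd_mul_left.mp h1
      exact hef.pow_right hge h2
    set γ : Fin 3 → K := fun j => α j / α i with hγ
    -- Subtracting a multiple of `N i` removes the term in `X 2 ^ 2`; a factor `e` then splits off,
    -- and it is coprime to `q`. What remains has degree `n + 2`.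
    have hqy : ∀ j, q ∣ f * (l j - C (γ j) * l i) + e * (Q j - C (γ j) * Q i) := by
      intro j
      refine hqe.dvd_of_dvd_mul_left ?_
      have h1 : C (α j) = C (γ j) * (C (α i) : MvPolynomial (Fin 2) K) := by
        rw [← C_mul, hγ, div_mul_cancel₀ _ hi]
      have : e * (f * (l j - C (γ j) * l i) + e * (Q j - C (γ j) * Q i)) =
          (C (α j) * f ^ 2 + e * (f * l j + e * Q j)) -
          C (γ j) * (C (α i) * f ^ 2 + e * (f * l i + e * Q i)) := by rw [h1]; ring
      rw [this]
      exact dvd_sub (hq j) ((hq i).mul_left _)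
    have hyh : ∀ j, (f * (l j - C (γ j) * l i) + e * (Q j - C (γ j) * Q i)).IsHomogeneous
        (n + 2) := fun j =>
      IsHomogeneous.add (hf.mul ((hlh j).sub ((hlh i).C_mul _)))
        (he.mul ((hQ j).sub ((hQ i).C_mul _)))
    by_cases hy : ∃ j, f * (l j - C (γ j) * l i) + e * (Q j - C (γ j) * Q i) ≠ 0
    · obtain ⟨j, hj⟩ := hy
      exact (totalDegree_le_of_dvd_of_isDomain (hqy j) hj).trans (hyh j).totalDegree_le
    push Not at hy
    exfalso
    -- If everything remaining is zero, coprimality makes `f` divide `Q j - C (γ j) * Q i`. As `2 ≤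
    -- n + 1` the quotient is constant, so three quadrics depend on two scalars each, `γ j` and `d
    -- j`, and are linearly dependent.
    have hd : ∀ j, ∃ d : K, Q j - C (γ j) * Q i = C d * f := by
      intro j
      refine exists_eq_C_mul_of_dvd ?_ ?_
      · refine hef.symm.dvd_of_dvd_mul_left ⟨-(l j - C (γ j) * l i), ?_⟩
        linear_combination hy j
      · rw [hf.totalDegree hf0]
        exact ((hQ j).sub ((hQ i).C_mul _)).totalDegree_le.trans (by omega)
    choose d hd using hd
    have hdl : ∀ j, l j - C (γ j) * l i = -C (d j) * e := fun j => by
      have := hy j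
      rw [hd] at this
      refine mul_left_cancel₀ hf0 ?_
      linear_combination this
    obtain ⟨κ, hκ0, h1, h2⟩ := exists_ne_zero_two_relations γ d
    have h1' := congrArg (C : K → MvPolynomial (Fin 2) K) h1
    have h2' := congrArg (C : K → MvPolynomial (Fin 2) K) h2
    simp only [Fin.sum_univ_three, map_add, map_mul, map_zero] at h1' h2'
    refine hκ0 (hcomb κ ?_ ?_ ?_)
    · have : ∑ j, κ j * α j = α i * ∑ j, κ j * γ j := by
        rw [Finset.mul_sum]
        refine Finset.sum_congr rfl fun j _ => ?_
        simp only [hγ]; field_simp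
      rw [this, h1, mul_zero]
    · rw [Fin.sum_univ_three]
      linear_combination l i * h1' - e * h2' + C (κ 0) * hdl 0 + C (κ 1) * hdl 1 +
        C (κ 2) * hdl 2
    · rw [Fin.sum_univ_three]
      linear_combination Q i * h1' + f * h2' + C (κ 0) * hd 0 + C (κ 1) * hd 1 +
        C (κ 2) * hd 2

end BaseDegree

/-! ### Normal form of the parameterization and its image under the transformation. -/

section QuadraticImage

variable {K : Type*} [Field K]

theorem exists_linear_coeffs {σ : Type*} [Fintype σ] {f : MvPolynomial σ K}
    (hf : f.IsHomogeneous 1) : ∃ c : σ → K, f = ∑ i, C (c i) * X i := by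
  rw [← mem_homogeneousSubmodule, homogeneousSubmodule_one_eq_span_X,
    Submodule.mem_span_range_iff_exists_fun] at hf
  obtain ⟨c, hc⟩ := hf
  exact ⟨c, by simp [← hc, smul_eq_C_mul]⟩

/-- The triple of linear forms whose coefficients are the rows of a matrix. -/
noncomputable def linearForms (A : Matrix (Fin 3) (Fin 3) K) (i : Fin 3) :
    MvPolynomial (Fin 3) K := ∑ j, C (A i j) * X j

theorem linearForms_isHomogeneous (A : Matrix (Fin 3) (Fin 3) K) (i : Fin 3) :
    (linearForms A i).IsHomogeneous 1 :=
  isHomogeneous_linearCombination (fun j => isHomogeneous_X K j) _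

theorem aeval_linearForms {R : Type*} [CommRing R] [Algebra K R]
    (A : Matrix (Fin 3) (Fin 3) K) (u : Fin 3 → R) (i : Fin 3) :
    aeval u (linearForms A i) = ∑ j, algebraMap K R (A i j) * u j := by
  simp [linearForms]

theorem aeval_linearForms_of_mul_eq_one {R : Type*} [CommRing R] [Algebra K R]
    {A B : Matrix (Fin 3) (Fin 3) K} (h : A * B = 1) (u : Fin 3 → R) (i : Fin 3) :
    aeval (fun j => aeval u (linearForms B j)) (linearForms A i) = u i := by
  simp only [aeval_linearForms, Finset.mul_sum]
  rw [Finset.sum_comm]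
  have h1 : ∀ k, ∑ j, algebraMap K R (A i j) * (algebraMap K R (B j k) * u k)
      = algebraMap K R ((1 : Matrix (Fin 3) (Fin 3) K) i k) * u k := fun k => by
    rw [← h, Matrix.mul_apply, map_sum, Finset.sum_mul]
    simp only [map_mul, mul_assoc]
  simp [h1, Matrix.one_apply]

/-- A parameterization inverted by a pencil of lines is, up to a linear change of coordinates, of
the form `(X 0 * e : X 1 * e : f)`. -/
theorem exists_normal_form [IsAlgClosed K] {C₀ : PlaneCurve K} {F : Fin 2 → MvPolynomial (Fin 3) K}
    (hF : C₀.IsParameterizableBy 1 F) :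
    ∃ (n : ℕ) (e f : MvPolynomial (Fin 2) K) (A B : Matrix (Fin 3) (Fin 3) K)
      (u : Fin 3 → MvPolynomial (Fin 2) K),
      A * B = 1 ∧ B * A = 1 ∧ e.IsHomogeneous n ∧ f.IsHomogeneous (n + 1) ∧ e ≠ 0 ∧
      IsRelPrime e f ∧ (∀ i, (u i).IsHomogeneous (n + 1)) ∧ NoCommonFactor u ∧
      aeval u C₀.poly = 0 ∧ (∀ i, aeval u (F i) = X i * e) ∧
      ∀ i, u i = aeval ![X 0 * e, X 1 * e, f] (linearForms A i) := by
  obtain ⟨hF1, -, n', u, hu, huc, huE, ⟨i₀, hi₀⟩, hψ, -⟩ := hF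
  have hX01 : ¬ (X 0 : MvPolynomial (Fin 2) K) ∣ X 1 := by
    rintro ⟨g, hg⟩
    have := congrArg (eval ![(0 : K), 1]) hg
    simp at this
  obtain ⟨e, he⟩ : (X 0 : MvPolynomial (Fin 2) K) ∣ aeval u (F 0) :=
    (X_prime.dvd_or_dvd (Dvd.intro _ hψ)).resolve_left hX01
  have hFe : ∀ i, aeval u (F i) = X i * e := by
    intro i
    fin_cases i
    · exact he
    · refine mul_left_cancel₀ (X_ne_zero (0 : Fin 2)) (hψ.trans ?_)
      rw [he]
      simp; ring
  have he0 : e ≠ 0 := fun h => hi₀ (by rw [hFe, h, mul_zero])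
  have hFh : ∀ i, (aeval u (F i)).IsHomogeneous n' := fun i => by
    simpa using (hF1 i).aeval u hu
  have heh : e.IsHomogeneous e.totalDegree :=
    isHomogeneous_of_dvd (hFh 0) (by rw [hFe]; exact mul_ne_zero (X_ne_zero _) he0)
      (by rw [hFe]; exact dvd_mul_left _ _)
  set n := e.totalDegree
  have hn : n' = n + 1 := by
    have h1 := hFh 0
    rw [hFe] at h1
    rw [add_comm]
    exact h1.inj_right ((isHomogeneous_X K 0).mul heh) (mul_ne_zero (X_ne_zero _) he0)
  subst hn
  choose r hr using fun i => exists_linear_coeffs (hF1 i)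
  have hrind : LinearIndependent K r := by
    rw [Fintype.linearIndependent_iff]
    intro g hg
    have h1 : ∑ i, C (g i) * F i = 0 := by
      simp only [hr, Finset.mul_sum]
      rw [Finset.sum_comm]
      refine Finset.sum_eq_zero fun j _ => ?_
      have := congrArg (C : K → MvPolynomial (Fin 3) K) (congrFun hg j)
      simp only [Fin.sum_univ_two, Pi.add_apply, Pi.smul_apply, smul_eq_mul, map_add, map_mul,
        Pi.zero_apply, map_zero] at this ⊢
      linear_combination X j * this
    have h2 := congrArg (aeval u) h1
    simp only [Fin.sum_univ_two, map_add, map_mul, hFe, map_zero, algHom_C, algebraMap_eq] at h2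
    have h3 : (C (g 0) * X 0 + C (g 1) * X 1 : MvPolynomial (Fin 2) K) = 0 := by
      refine (mul_eq_zero.mp ?_).resolve_right he0
      linear_combination h2
    have h4 := congrArg (eval ![(1 : K), 0]) h3
    have h5 := congrArg (eval ![(0 : K), 1]) h3
    intro i
    fin_cases i
    · simpa using h4
    · simpa using h5
  -- The two lines of the pencil become the first two coordinates; any completion to a basis
  -- supplies the third.
  obtain ⟨c, hc⟩ := exists_linearIndependent_snoc_of_lt_finrank hrind (by simp)
  set B : Matrix (Fin 3) (Fin 3) K := Matrix.of (Fin.snoc r c) with hB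
  have hBu : IsUnit B := Matrix.linearIndependent_rows_iff_isUnit.mp hc
  have hBF : ∀ i : Fin 2, linearForms B i.castSucc = F i := fun i => by
    rw [hr, linearForms]
    simp [hB, Matrix.of_apply]
  have hdet := (Matrix.isUnit_iff_isUnit_det _).mp hBu
  have hAB : B⁻¹ * B = 1 := Matrix.nonsing_inv_mul _ hdet
  have hBA : B * B⁻¹ = 1 := Matrix.mul_nonsing_inv _ hdet
  set f := aeval u (linearForms B 2) with hf
  have hBuf : (fun i => aeval u (linearForms B i)) = ![X 0 * e, X 1 * e, f] := by
    funext i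
    fin_cases i
    · exact (congrArg (aeval u) (hBF 0)).trans (hFe 0)
    · exact (congrArg (aeval u) (hBF 1)).trans (hFe 1)
    · rfl
  have huA : ∀ i, u i = aeval ![X 0 * e, X 1 * e, f] (linearForms B⁻¹ i) := fun i => by
    rw [← hBuf, aeval_linearForms_of_mul_eq_one hAB]
  refine ⟨n, e, f, B⁻¹, B, u, hAB, hBA, heh, ?_, he0, ?_, hu, huc, huE, hFe, huA⟩
  · have := (linearForms_isHomogeneous B 2).aeval u hu
    rwa [mul_one] at this
  · intro g hge hgf
    refine huc g fun i => ?_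
    rw [huA, aeval_linearForms]
    refine Finset.dvd_sum fun j _ => Dvd.dvd.mul_left ?_ _
    fin_cases j
    · exact hge.mul_left _
    · exact hge.mul_left _
    · exact hgf

/-- A curve with a parameterization `(X 0 * e : X 1 * e : f)` has an equation of degree
`deg f`. -/
theorem degree_le_of_normal_form {C₀ : PlaneCurve K} {n : ℕ} {e f : MvPolynomial (Fin 2) K}
    {A B : Matrix (Fin 3) (Fin 3) K} {u : Fin 3 → MvPolynomial (Fin 2) K} (hBA : B * A = 1)
    (he : e.IsHomogeneous n) (hf : f.IsHomogeneous (n + 1)) (he0 : e ≠ 0)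
    (hu : ∀ g : MvPolynomial (Fin 3) K, C₀.poly ∣ g ↔ aeval u g = 0)
    (huA : ∀ i, u i = aeval ![X 0 * e, X 1 * e, f] (linearForms A i)) : C₀.degree ≤ n + 1 := by
  set L := linearForms B with hL
  have hLh : ∀ i, (L i).IsHomogeneous 1 := linearForms_isHomogeneous B
  have hLu : ∀ i, aeval u (L i) = ![X 0 * e, X 1 * e, f] i := fun i => by
    rw [funext huA, hL, aeval_linearForms_of_mul_eq_one hBA]
  set P := L 2 * aeval ![L 0, L 1] e - aeval ![L 0, L 1] f with hP
  have hL01 : ∀ i, (![L 0, L 1] i).IsHomogeneous 1 := fun i => by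
    fin_cases i
    exacts [hLh 0, hLh 1]
  have hPh : P.IsHomogeneous (n + 1) := by
    refine IsHomogeneous.sub ?_ (by simpa using hf.aeval _ hL01)
    rw [add_comm]
    exact (hLh 2).mul (by simpa using he.aeval _ hL01)
  have hcomp : ∀ {R : Type _} [CommRing R] [Algebra K R] (φ : MvPolynomial (Fin 3) K →ₐ[K] R)
      (g : MvPolynomial (Fin 2) K), φ (aeval ![L 0, L 1] g) = aeval ![φ (L 0), φ (L 1)] g := by
    intro R _ _ φ g
    rw [comp_aeval_apply]
    congr 1
    congr 1
    funext i; fin_cases i <;> rfl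
  have hPu : aeval u P = 0 := by
    have h1 : (![X 0 * e, X 1 * e] : Fin 2 → MvPolynomial (Fin 2) K) = fun i => e * X i := by
      funext i; fin_cases i <;> simp [mul_comm]
    rw [hP, map_sub, map_mul, hcomp, hcomp, hLu, hLu, hLu]
    simp only [Matrix.cons_val]
    rw [h1, aeval_smul_of_isHomogeneous he, aeval_smul_of_isHomogeneous hf, aeval_X_left,
      AlgHom.id_apply, AlgHom.id_apply]
    ring
  have hP0 : P ≠ 0 := by
    intro h0
    have hLA : ∀ i, aeval (linearForms A) (L i) = X i := fun i => by
      have := aeval_linearForms_of_mul_eq_one hBA (X : Fin 3 → MvPolynomial (Fin 3) K) i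
      simpa only [aeval_X_left, AlgHom.id_apply] using this
    have h1 := congrArg (aeval (linearForms A)) h0
    rw [hP, map_sub, map_mul, hcomp, hcomp, hLA, hLA, hLA, map_zero] at h1
    set ι : MvPolynomial (Fin 2) K →ₐ[K] MvPolynomial (Fin 3) K := aeval ![X 0, X 1] with hι
    have h2 : ∀ z : MvPolynomial (Fin 2) K, ∀ g, aeval ![X 0, X 1, z] (ι g) = g := fun z g => by
      have : (aeval ![X 0, X 1, z]).comp ι = AlgHom.id K _ := by
        ext i; fin_cases i <;> simp [hι]
      exact DFunLike.congr_fun this g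
    have h3 := congrArg (aeval ![(X 0 : MvPolynomial (Fin 2) K), X 1, 0]) h1
    have h4 := congrArg (aeval ![(X 0 : MvPolynomial (Fin 2) K), X 1, 1]) h1
    simp only [map_sub, map_mul, h2, aeval_X, map_zero] at h3 h4
    simp only [Matrix.cons_val] at h3 h4
    -- The values at `X 2 = 1` and `X 2 = 0` differ by `e`.
    exact he0 (by linear_combination h4 - h3)
  rw [← C₀.homogeneous.totalDegree C₀.irreducible.ne_zero]
  exact (totalDegree_le_of_dvd_of_isDomain ((hu P).mpr hPu) hP0).trans hPh.totalDegree_le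

/-- The parameterization of the image of a curve with parameterization `(X 0 * e : X 1 * e : f)`
under a quadratic transformation has degree at least `deg e`. -/
theorem exists_image_parameterization {n : ℕ} {e f : MvPolynomial (Fin 2) K}
    {A B : Matrix (Fin 3) (Fin 3) K} {u : Fin 3 → MvPolynomial (Fin 2) K} (hAB : A * B = 1)
    (hBA : B * A = 1) (hn : 1 ≤ n) (he : e.IsHomogeneous n) (hf : f.IsHomogeneous (n + 1))
    (he0 : e ≠ 0) (hf0 : f ≠ 0) (hef : IsRelPrime e f) (hu : ∀ i, (u i).IsHomogeneous (n + 1))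
    (huA : ∀ i, u i = aeval ![X 0 * e, X 1 * e, f] (linearForms A i))
    {Λ M : PlaneRationalMap K} (hΛ : Λ.degree = 2) (hΛM : Λ.IsInverse M)
    (hΛu : ∃ i, aeval u (Λ.form i) ≠ 0) :
    ∃ (q : MvPolynomial (Fin 2) K) (w : Fin 3 → MvPolynomial (Fin 2) K) (m : ℕ),
      (∀ i, aeval u (Λ.form i) = q * w i) ∧ NoCommonFactor w ∧ (∀ i, (w i).IsHomogeneous m) ∧
      n ≤ m := by
  obtain ⟨q, w, hqw, hwc⟩ := exists_eq_mul_noCommonFactor hΛu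
  obtain ⟨⟨h, hh0, hh⟩, ⟨k, hk0, hk⟩⟩ := hΛM
  set N : Fin 3 → MvPolynomial (Fin 3) K := fun i => aeval (linearForms A) (Λ.form i) with hNdef
  have hΛh : ∀ i, (Λ.form i).IsHomogeneous 2 := fun i => hΛ ▸ Λ.homogeneous i
  have hNu : ∀ i, aeval ![X 0 * e, X 1 * e, f] (N i) = q * w i := fun i => by
    rw [hNdef, comp_aeval_apply, ← funext huA, hqw]
  have hN : ∀ i, (N i).IsHomogeneous 2 := fun i => by
    have := (hΛh i).aeval _ (linearForms_isHomogeneous A)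
    rwa [one_mul] at this
  have hBA' : ∀ g, aeval (linearForms B) (aeval (linearForms A) g) = g := fun g => by
    rw [comp_aeval_apply]
    have := fun i => aeval_linearForms_of_mul_eq_one hAB (X : Fin 3 → MvPolynomial (Fin 3) K) i
    simp only [aeval_X_left, AlgHom.id_apply] at this
    rw [funext this, aeval_X_left, AlgHom.id_apply]
  -- A linear relation among the forms of `Λ`, composed with `M`, would be one among the
  -- coordinates.
  have hind : ∀ κ : Fin 3 → K, ∑ i, C (κ i) * N i = 0 → κ = 0 := by
    intro κ hκ
    have h1 := congrArg (aeval M.form) (congrArg (aeval (linearForms B)) hκ)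
    simp only [map_sum, map_mul, algHom_C, algebraMap_eq, hNdef, hBA', hk, map_zero] at h1
    have h2 : ∑ i, C (κ i) * X i = (0 : MvPolynomial (Fin 3) K) := by
      refine (mul_eq_zero.mp ?_).resolve_left hk0
      rw [← h1, Finset.mul_sum]
      exact Finset.sum_congr rfl fun i _ => by ring
    funext i
    have h3 := congrArg (eval (Pi.single i 1)) h2
    simpa [Pi.single_apply] using h3
  -- If no `N i` involved `X 2`, neither would their composite with `M`. But that composite recovers
  -- `H * X 2` with `H ≠ 0`, which vanishes at `X 2 = 0`.
  have hdep : ¬ ∀ i, aeval ![(X 0 : MvPolynomial (Fin 3) K), X 1, 0] (N i) = N i := by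
    intro hρ
    set ρ : MvPolynomial (Fin 3) K →ₐ[K] MvPolynomial (Fin 3) K := aeval ![X 0, X 1, 0] with hρdef
    set H := aeval (linearForms A) h with hH
    have h1 : ∀ i, aeval N (M.form i) = H * linearForms A i := fun i => by
      have := congrArg (aeval (linearForms A)) (hh i)
      rw [comp_aeval_apply, map_mul, aeval_X] at this
      exact this
    have h2 : ∀ i, ρ (H * linearForms A i) = H * linearForms A i := fun i => by
      rw [← h1, comp_aeval_apply, funext hρ]
    have h3 : H * X 2 = ∑ i, C (B 2 i) * (H * linearForms A i) := by
      have := aeval_linearForms_of_mul_eq_one hBA (X : Fin 3 → MvPolynomial (Fin 3) K) 2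
      rw [aeval_linearForms] at this
      simp only [aeval_X_left, AlgHom.id_apply, algebraMap_eq] at this
      rw [← this, Finset.mul_sum]
      exact Finset.sum_congr rfl fun i _ => by ring
    have h4 : ρ (H * X 2) = H * X 2 := by
      rw [h3, map_sum]
      refine Finset.sum_congr rfl fun i _ => ?_
      rw [map_mul, h2, algHom_C, algebraMap_eq]
    have h5 : ρ (X 2) = 0 := by simp [hρdef]
    rw [map_mul, h5, mul_zero] at h4
    have h6 : H = 0 := (mul_eq_zero.mp h4.symm).resolve_right (X_ne_zero _)
    have h7 := congrArg (aeval (linearForms B)) h6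
    rw [hH, hBA', map_zero] at h7
    exact hh0 h7
  have hdeg : q.totalDegree ≤ n + 2 :=
    totalDegree_le_of_dvd_quadratic hN hind hdep hn he hf he0 hf0 hef
      fun i => by rw [hNu]; exact dvd_mul_right _ _
  have hqwh : ∀ i, (q * w i).IsHomogeneous (2 * (n + 1)) := fun i => by
    rw [← hqw, mul_comm]
    exact (hΛh i).aeval u hu
  obtain ⟨i₀, hi₀⟩ := hΛu
  have hq0 : q ≠ 0 := fun h => hi₀ (by rw [hqw, h, zero_mul])
  refine ⟨q, w, 2 * (n + 1) - q.totalDegree, hqw, hwc, fun i => ?_, by omega⟩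
  by_cases hi : w i = 0
  · rw [hi]
    exact isHomogeneous_zero _ _ _
  have h0 := mul_ne_zero hq0 hi
  have h1 := isHomogeneous_of_dvd (hqwh i) h0 (dvd_mul_left _ _)
  have h2 := (hqwh i).totalDegree h0
  rw [totalDegree_mul_of_isDomain hq0 hi] at h2
  rwa [show 2 * (n + 1) - q.totalDegree = (w i).totalDegree by omega]

end QuadraticImage

/-! ### The two degree bounds. -/

section Bounds

variable {K : Type*} [Field K]

theorem dvd_iff_of_parameterizes [Infinite K] {E : MvPolynomial (Fin 3) K} (hE : Irreducible E)
    {w : Fin 3 → MvPolynomial (Fin 2) K} {m : ℕ} (hw : ∀ i, (w i).IsHomogeneous m) (hm : 1 ≤ m)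
    (hc : NoCommonFactor w) (h0 : ∃ i, w i ≠ 0) (hEw : aeval w E = 0)
    (f : MvPolynomial (Fin 3) K) : E ∣ f ↔ aeval w f = 0 :=
  dvd_iff_aeval_eq_zero hw hm (hc.exists_independent_values hw hm h0) hE hEw

/-- The curve is not in the base locus: its equation would be a common factor of the forms of `Λ`.
-/
theorem PlaneRationalMap.exists_aeval_ne_zero {Λ : PlaneRationalMap K} {E : MvPolynomial (Fin 3) K}
    (hE : Irreducible E) {u : Fin 3 → MvPolynomial (Fin 2) K}
    (hu : ∀ f, E ∣ f ↔ aeval u f = 0) : ∃ i, aeval u (Λ.form i) ≠ 0 := by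
  by_contra! h
  exact hE.not_isUnit (Λ.noCommonFactor _ fun i => (hu _).mpr (h i))

/-- The degree of the image curve is at least that of its parameterization. -/
theorem degree_le_degree_image [IsAlgClosed K] {C : PlaneCurve K} {Λ M : PlaneRationalMap K}
    (hΛM : Λ.IsInverse M) {F : Fin 2 → MvPolynomial (Fin 3) K} (hF : ∀ i, (F i).IsHomogeneous 1)
    {u w : Fin 3 → MvPolynomial (Fin 2) K} {e q : MvPolynomial (Fin 2) K} (he : e ≠ 0)
    (hFu : ∀ i, aeval u (F i) = X i * e) (hqw : ∀ i, aeval u (Λ.form i) = q * w i) (hq : q ≠ 0)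
    {m : ℕ} (hw : ∀ i, (w i).IsHomogeneous m) (hm : 1 ≤ m) (hwc : NoCommonFactor w)
    (hw0 : ∃ i, w i ≠ 0) (hC : aeval w C.poly = 0) : m ≤ C.degree := by
  obtain ⟨⟨h, hh0, hh⟩, -⟩ := hΛM
  have hcomp : ∀ g, aeval (fun i => aeval u (Λ.form i)) g = aeval u (aeval Λ.form g) := fun g => by
    rw [comp_aeval_apply]
  -- If `h` vanished along the curve, all forms of `M` would vanish on the image and share its
  -- equation as a factor.
  have hhu : aeval u h ≠ 0 := by
    intro h0
    refine C.irreducible.not_isUnit (M.noCommonFactor _ fun i => ?_)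
    rw [dvd_iff_of_parameterizes C.irreducible hw hm hwc hw0 hC,
      ← aeval_mul_eq_zero_iff (M.homogeneous i) hq hqw, hcomp, hh, map_mul, h0, zero_mul]
  -- Up to non-zero factors independent of `i`, the pencil after `M` sends `w` back to the parameter
  -- `X i`.
  have hR : ∀ i, q ^ (M.degree * 1) * aeval w (aeval M.form (F i)) = aeval u h * (X i * e) := by
    intro i
    have h1 := (hF i).aeval M.form M.homogeneous
    rw [← aeval_smul_of_isHomogeneous h1, ← funext hqw, hcomp,
      comp_aeval_apply (φ := aeval Λ.form), funext hh,
      aeval_smul_of_isHomogeneous (hF i), aeval_X_left, AlgHom.id_apply, pow_one, map_mul, hFu]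
  have hqp : q ^ (M.degree * 1) ≠ 0 := pow_ne_zero _ hq
  refine degree_le_of_birational_parameterization hw hwc C.homogeneous C.irreducible.ne_zero hC
    ((hF 0).aeval M.form M.homogeneous) ((hF 1).aeval M.form M.homogeneous) ?_ ?_
  · refine mul_left_cancel₀ hqp ?_
    linear_combination X 1 * hR 0 - X 0 * hR 1
  · intro h0
    have := hR 1
    rw [h0, mul_zero] at this
    exact mul_ne_zero hhu (mul_ne_zero (X_ne_zero _) he) this.symm

/-- The pull-back of the equation of a curve under the inverse of `Λ` vanishes on its image. -/
theorem pullback_vanishes_on_image {C₀ : PlaneCurve K} {Λ M : PlaneRationalMap K}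
    (hΛM : Λ.IsInverse M) {u w : Fin 3 → MvPolynomial (Fin 2) K} {q : MvPolynomial (Fin 2) K}
    (hu : aeval u C₀.poly = 0) (hqw : ∀ i, aeval u (Λ.form i) = q * w i) (hq : q ≠ 0) :
    aeval M.form C₀.poly ≠ 0 ∧ aeval w (aeval M.form C₀.poly) = 0 := by
  obtain ⟨⟨h, hh0, hh⟩, -⟩ := hΛM
  have h1 : aeval Λ.form (aeval M.form C₀.poly) = h ^ C₀.degree * C₀.poly := by
    rw [comp_aeval_apply, funext hh, aeval_smul_of_isHomogeneous C₀.homogeneous, aeval_X_left,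
      AlgHom.id_apply]
  constructor
  · intro h0
    rw [h0, map_zero] at h1
    exact mul_ne_zero (pow_ne_zero _ hh0) C₀.irreducible.ne_zero h1.symm
  · have h2 := C₀.homogeneous.aeval M.form M.homogeneous
    have h3 := congrArg (aeval u) h1
    rw [← aeval_mul_eq_zero_iff h2 hq hqw]
    rw [comp_aeval_apply (φ := aeval u), map_mul, hu, mul_zero] at h3
    exact h3

/-- The forms vanishing along `w` lie in a prime ideal, non-zero because it contains the pull-back.
In a factorial ring it contains a prime element, which is homogeneous as a divisor of that
pull-back. -/
theorem exists_image_curve [Infinite K] {C₀ : PlaneCurve K} {Λ M : PlaneRationalMap K}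
    (hΛM : Λ.IsInverse M) {u w : Fin 3 → MvPolynomial (Fin 2) K} {q : MvPolynomial (Fin 2) K}
    (hu : aeval u C₀.poly = 0) (hqw : ∀ i, aeval u (Λ.form i) = q * w i) (hq : q ≠ 0) {m : ℕ}
    (hw : ∀ i, (w i).IsHomogeneous m) (hm : 1 ≤ m) (hwc : NoCommonFactor w)
    (hw0 : ∃ i, w i ≠ 0) : ∃ C : PlaneCurve K, aeval w C.poly = 0 := by
  obtain ⟨hP0, hPw⟩ := pullback_vanishes_on_image hΛM hu hqw hq
  have hprime : (RingHom.ker (aeval w : MvPolynomial (Fin 3) K →ₐ[K] _)).IsPrime :=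
    RingHom.ker_isPrime _
  obtain ⟨G, hGw, hG⟩ := hprime.exists_mem_prime_of_ne_bot
    (fun hbot => hP0 ((Submodule.mem_bot _).mp (hbot ▸ RingHom.mem_ker.mpr hPw)))
  have hdvd := (dvd_iff_of_parameterizes hG.irreducible hw hm hwc hw0 hGw _).mpr hPw
  exact ⟨⟨G.totalDegree, G, isHomogeneous_of_dvd
    (C₀.homogeneous.aeval M.form M.homogeneous) hP0 hdvd, hG.irreducible⟩, hGw⟩

theorem degree_image_le [Infinite K] {C₀ C : PlaneCurve K} {Λ M : PlaneRationalMap K}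
    (hΛM : Λ.IsInverse M) {u w : Fin 3 → MvPolynomial (Fin 2) K} {q : MvPolynomial (Fin 2) K}
    (hu : aeval u C₀.poly = 0) (hqw : ∀ i, aeval u (Λ.form i) = q * w i) (hq : q ≠ 0) {m : ℕ}
    (hw : ∀ i, (w i).IsHomogeneous m) (hm : 1 ≤ m) (hwc : NoCommonFactor w)
    (hw0 : ∃ i, w i ≠ 0) (hC : aeval w C.poly = 0) : C.degree ≤ M.degree * C₀.degree := by
  obtain ⟨hP0, hPw⟩ := pullback_vanishes_on_image hΛM hu hqw hq
  have hdvd := (dvd_iff_of_parameterizes C.irreducible hw hm hwc hw0 hC _).mpr hPw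
  rw [← C.homogeneous.totalDegree C.irreducible.ne_zero]
  exact (totalDegree_le_of_dvd_of_isDomain hdvd hP0).trans
    (C₀.homogeneous.aeval M.form M.homogeneous).totalDegree_le

theorem quadratic_image_degree_bounds [IsAlgClosed K] (C₀ : PlaneCurve K) (Λ : PlaneRationalMap K)
    (hd : 1 < C₀.degree) (hC₀ : C₀.IsParameterizableByLines)
    (hΛ : Λ.IsQuadraticWithQuadraticInverse) :
    (∃ C : PlaneCurve K, C.points = zariskiClosure (Λ.image C₀.points)) ∧
      ∀ C : PlaneCurve K, C.points = zariskiClosure (Λ.image C₀.points) →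
        C₀.degree - 1 ≤ C.degree ∧ C.degree ≤ 2 * C₀.degree := by
  obtain ⟨⟨hΛ2, -⟩, M, hM2, hΛM⟩ := hΛ
  obtain ⟨F, hF⟩ := hC₀
  obtain ⟨n, e, f, A, B, u, hAB, hBA, he, hf, he0, hef, hu, huc, huE, hFu, huA⟩ :=
    exists_normal_form hF
  have hu0 : ∃ i, u i ≠ 0 := by
    by_contra! h
    have h1 := hFu 0
    rw [funext h, show (fun _ : Fin 3 => (0 : MvPolynomial (Fin 2) K)) = fun i => 0 * u i by simp,
      aeval_smul_of_isHomogeneous (hF.1 0), pow_one, zero_mul] at h1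
    exact mul_ne_zero (X_ne_zero _) he0 h1.symm
  have hker := dvd_iff_of_parameterizes C₀.irreducible hu (by omega) huc hu0 huE
  have hdn := degree_le_of_normal_form hBA he hf he0 hker huA
  have hn : 1 ≤ n := by omega
  -- With `f = 0`, coprimality would make `e` a unit, against `n ≥ 1`.
  have hf0 : f ≠ 0 := by
    rintro rfl
    rw [isRelPrime_zero_right] at hef
    obtain ⟨c, -, hc⟩ := isUnit_iff_eq_C_of_isReduced.mp hef
    have := he.totalDegree he0
    rw [hc, totalDegree_C] at this
    omega
  have hΛu := Λ.exists_aeval_ne_zero C₀.irreducible hker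
  obtain ⟨q, w, m, hqw, hwc, hw, hnm⟩ :=
    exists_image_parameterization hAB hBA hn he hf he0 hf0 hef hu huA hΛ2 hΛM hΛu
  obtain ⟨i, hi⟩ := hΛu
  rw [hqw] at hi
  have hq : q ≠ 0 := left_ne_zero_of_mul hi
  have hw0 : ∃ i, w i ≠ 0 := ⟨i, right_ne_zero_of_mul hi⟩
  have hm : 1 ≤ m := hn.trans hnm
  have hclosure : ∀ C : PlaneCurve K, C.points = zariskiClosure (Λ.image C₀.points) ↔
      aeval w C.poly = 0 := fun C =>
    points_eq_zariskiClosure_iff C₀ C Λ (by omega) hker hqw ⟨i, by rwa [hqw]⟩ hw hm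
      (hwc.exists_independent_values hw hm hw0)
  constructor
  · obtain ⟨C, hC⟩ := exists_image_curve hΛM huE hqw hq hw hm hwc hw0
    exact ⟨C, (hclosure C).mpr hC⟩
  · intro C hC
    rw [hclosure] at hC
    have h1 := degree_le_degree_image hΛM hF.1 he0 hFu hqw hq hw hm hwc hw0 hC
    have h2 := degree_image_le hΛM huE hqw hq hw hm hwc hw0 hC
    rw [hM2] at h2
    exact ⟨by omega, h2⟩

end Bounds

/-! ### Examples attaining both bounds. -/

section Sharpness

variable {K : Type*} [Field K]

theorem noCommonFactor_of_isRelPrime {R ι : Type*} [CommRing R] {f : ι → R} (i j : ι)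
    (h : IsRelPrime (f i) (f j)) : NoCommonFactor f := fun _ hg => h (hg i) (hg j)

theorem isRelPrime_X_pow {σ : Type*} {i : σ} {g : MvPolynomial σ K} (a : σ → K) (ha : a i = 0)
    (hg : eval a g ≠ 0) (n : ℕ) : IsRelPrime (X i ^ n) g := by
  refine IsRelPrime.pow_left ?_
  refine (X_prime (i := i)).irreducible.isRelPrime_iff_not_dvd.mpr ?_
  rintro ⟨h, rfl⟩
  simp [ha] at hg

/-- The curve `x ^ (k + 2) = z y ^ (k + 1)`. -/
noncomputable def monomialCurve (K : Type*) [Field K] (k : ℕ) : PlaneCurve K where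
  degree := k + 2
  poly := -X 1 ^ (k + 1) * X 2 + X 0 ^ (k + 2)
  homogeneous := ((isHomogeneous_X_pow 1 (k + 1)).neg.mul (isHomogeneous_X K 2)).add
    (isHomogeneous_X_pow 0 (k + 2))
  irreducible := by
    have hX : ∀ (i : Fin 3) (n : ℕ), i ≠ 2 →
        (2 : Fin 3) ∉ (X i ^ n : MvPolynomial (Fin 3) K).vars :=
      fun i n hi h => by
        have := vars_pow _ _ h
        rw [vars_X, Finset.mem_singleton] at this
        exact hi this.symm
    -- The equation is linear in `X 2` with coprime coefficients.
    refine irreducible_mul_X_add _ _ 2 (neg_ne_zero.mpr (pow_ne_zero _ (X_ne_zero _))) ?_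
      (hX 0 _ (by decide)) ?_
    · rw [vars_neg]
      exact hX 1 _ (by decide)
    · refine (isRelPrime_X_pow ![1, 0, 0] rfl ?_ _).neg_left
      simp

/-- The parameterization of the monomial curve. -/
noncomputable def monomialParam (K : Type*) [Field K] (k : ℕ) : Fin 3 → MvPolynomial (Fin 2) K :=
  ![X 0 * X 1 ^ (k + 1), X 1 ^ (k + 2), X 0 ^ (k + 2)]

theorem monomialParam_isHomogeneous (k : ℕ) (i : Fin 3) :
    (monomialParam K k i).IsHomogeneous (k + 2) := by
  fin_cases i
  · have := (isHomogeneous_X K (0 : Fin 2)).mul (isHomogeneous_X_pow (R := K) 1 (k + 1))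
    rwa [show 1 + (k + 1) = k + 2 by ring] at this
  · exact isHomogeneous_X_pow _ _
  · exact isHomogeneous_X_pow _ _

theorem monomialParam_noCommonFactor (k : ℕ) : NoCommonFactor (monomialParam K k) := by
  refine noCommonFactor_of_isRelPrime 1 2 ?_
  exact isRelPrime_X_pow ![1, 0] rfl (by simp [monomialParam]) _

theorem aeval_monomialParam_poly (k : ℕ) :
    aeval (monomialParam K k) (monomialCurve K k).poly = 0 := by
  simp [monomialParam, monomialCurve]
  ring

theorem aeval_monomialParam_X (k : ℕ) (i : Fin 2) :
    aeval (monomialParam K k) ((![X 0, X 1] : Fin 2 → MvPolynomial (Fin 3) K) i) =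
      X i * X 1 ^ (k + 1) := by
  fin_cases i <;> simp [monomialParam]
  ring

theorem monomialCurve_isParameterizableByLines (k : ℕ) :
    (monomialCurve K k).IsParameterizableByLines := by
  refine ⟨![X 0, X 1], fun i => ?_, ?_, k + 2, monomialParam K k, monomialParam_isHomogeneous k,
    monomialParam_noCommonFactor k, aeval_monomialParam_poly k, ⟨0, ?_⟩, ?_, ⟨1, ?_⟩, ?_⟩
  · fin_cases i <;> exact isHomogeneous_X _ _
  · refine noCommonFactor_of_isRelPrime 0 1 ?_
    have := isRelPrime_X_pow (K := K) (i := (0 : Fin 3)) (g := X 1) ![0, 1, 0] rfl (by simp) 1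
    simpa using this
  · rw [aeval_monomialParam_X]
    exact mul_ne_zero (X_ne_zero _) (pow_ne_zero _ (X_ne_zero _))
  · rw [aeval_monomialParam_X, aeval_monomialParam_X]
    ring
  · rintro ⟨g, hg⟩
    -- The point `(1 : 1 : 1)` lies on the curve, while the form in question has value 1 there.
    have := congrArg (eval ![(1 : K), 1, 1]) hg
    simp [monomialParam, monomialCurve] at this
  · have hE : (monomialCurve K k).poly = -X 1 ^ (k + 1) * X 2 + X 0 ^ (k + 2) := rfl
    rw [hE]
    intro i j
    fin_cases i <;> fin_cases j <;> simp [monomialParam]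
    · exact ⟨0, by ring⟩
    · exact ⟨-X 0, by ring⟩
    · exact ⟨0, by ring⟩
    · exact ⟨-X 1, by ring⟩
    · exact ⟨X 0, by ring⟩
    · exact ⟨X 1, by ring⟩

theorem monomialCurve_hasMultiplicity (k : ℕ) :
    (monomialCurve K k).HasMultiplicityAtOrigin (k + 1) := by
  have h : aeval ![(X 0 : MvPolynomial (Fin 2) K), X 1, 1] (monomialCurve K k).poly
      = -X 1 ^ (k + 1) + X 0 ^ (k + 2) := by
    simp [monomialCurve]
  unfold PlaneCurve.HasMultiplicityAtOrigin
  rw [h]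
  have h1 : (X 1 ^ (k + 1) : MvPolynomial (Fin 2) K) ∈ homogeneousSubmodule (Fin 2) K (k + 1) :=
    isHomogeneous_X_pow _ _
  have h2 : (X 0 ^ (k + 2) : MvPolynomial (Fin 2) K) ∈ homogeneousSubmodule (Fin 2) K (k + 2) :=
    isHomogeneous_X_pow _ _
  simp only [map_add, map_neg, homogeneousComponent_of_mem h1, homogeneousComponent_of_mem h2]
  refine ⟨fun j hj => ?_, ?_⟩
  · rw [if_neg (by omega), if_neg (by omega)]
    simp
  · rw [if_pos trivial, if_neg (by omega), add_zero]
    exact neg_ne_zero.mpr (pow_ne_zero _ (X_ne_zero _))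

theorem dvd_iff_monomialParam [Infinite K] (k : ℕ) (f : MvPolynomial (Fin 3) K) :
    (monomialCurve K k).poly ∣ f ↔ aeval (monomialParam K k) f = 0 :=
  dvd_iff_of_parameterizes (monomialCurve K k).irreducible (monomialParam_isHomogeneous k)
    (by omega) (monomialParam_noCommonFactor k)
    ⟨1, pow_ne_zero _ (X_ne_zero _)⟩ (aeval_monomialParam_poly k) f

theorem isHomogeneous_X_mul_X (i j : Fin 3) :
    (X i * X j : MvPolynomial (Fin 3) K).IsHomogeneous 2 :=
  (isHomogeneous_X K i).mul (isHomogeneous_X K j)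

/-- The quadratic transformation `(x z + ε y² : y z : z²)`. -/
noncomputable def shearMap (ε : K) (hε : ε ≠ 0) : PlaneRationalMap K where
  degree := 2
  form := ![X 0 * X 2 + C ε * X 1 ^ 2, X 1 * X 2, X 2 ^ 2]
  homogeneous i := by
    fin_cases i
    · exact (isHomogeneous_X_mul_X 0 2).add ((isHomogeneous_X_pow 1 2).C_mul ε)
    · exact isHomogeneous_X_mul_X 1 2
    · exact isHomogeneous_X_pow 2 2
  noCommonFactor := noCommonFactor_of_isRelPrime 2 0
    (isRelPrime_X_pow ![0, 1, 0] rfl (by simpa using hε) 2)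

theorem shearMap_comp {ε δ : K} (hε : ε ≠ 0) (hδ : δ ≠ 0) (h : ε + δ = 0) (i : Fin 3) :
    aeval (shearMap ε hε).form ((shearMap δ hδ).form i) = X 2 ^ 3 * X i := by
  have h' : (C ε + C δ : MvPolynomial (Fin 3) K) = 0 := by rw [← C_add, h, C_0]
  fin_cases i <;> simp [shearMap]
  · linear_combination X 1 ^ 2 * X 2 ^ 2 * h'
  · ring
  · ring

theorem shearMap_isInverse : (shearMap (1 : K) one_ne_zero).IsInverse
    (shearMap (-1 : K) (neg_ne_zero.mpr one_ne_zero)) :=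
  ⟨⟨X 2 ^ 3, pow_ne_zero _ (X_ne_zero _), shearMap_comp _ _ (by ring)⟩,
    ⟨X 2 ^ 3, pow_ne_zero _ (X_ne_zero _), shearMap_comp _ _ (by ring)⟩⟩

/-- The only base point of the shear is `(1 : 0 : 0)`, which is off the curve. So nothing cancels
and `w` keeps the full degree `2 * (k + 2)`. -/
theorem upper_bound_attained [IsAlgClosed K] (k : ℕ) :
    ∃ (C : PlaneCurve K) (Λ : PlaneRationalMap K), Λ.IsQuadraticWithQuadraticInverse ∧
      C.points = zariskiClosure (Λ.image (monomialCurve K k).points) ∧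
      C.degree = 2 * (k + 2) := by
  set Λ := shearMap (1 : K) one_ne_zero with hΛ
  have hΛM := shearMap_isInverse (K := K)
  have hΛq : Λ.IsQuadraticWithQuadraticInverse := ⟨⟨rfl, _, hΛM⟩, _, rfl, hΛM⟩
  obtain ⟨⟨C, hC⟩, hbounds⟩ := quadratic_image_degree_bounds (monomialCurve K k) Λ
    (by change 1 < k + 2; omega) (monomialCurve_isParameterizableByLines k) hΛq
  refine ⟨C, Λ, hΛq, hC, le_antisymm (hbounds C hC).2 ?_⟩
  set w : Fin 3 → MvPolynomial (Fin 2) K := fun i => aeval (monomialParam K k) (Λ.form i) with hwdef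
  have hw : ∀ i, (w i).IsHomogeneous (2 * (k + 2)) := fun i => by
    rw [mul_comm]
    exact (Λ.homogeneous i).aeval _ (monomialParam_isHomogeneous k)
  have hw2 : w 2 = X 0 ^ (2 * (k + 2)) := by
    simp [hwdef, hΛ, shearMap, monomialParam]
    ring
  have hw2' : w 2 ≠ 0 := hw2 ▸ pow_ne_zero _ (X_ne_zero _)
  have hwc : NoCommonFactor w := by
    refine noCommonFactor_of_isRelPrime 2 0 ?_
    rw [hw2]
    refine isRelPrime_X_pow ![0, 1] rfl ?_ _
    simp [hwdef, hΛ, shearMap, monomialParam]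
  have hm : 1 ≤ 2 * (k + 2) := by omega
  have hqw : ∀ i, aeval (monomialParam K k) (Λ.form i) = 1 * w i := fun i => (one_mul _).symm
  have hCw := (points_eq_zariskiClosure_iff (monomialCurve K k) C Λ two_ne_zero
    (dvd_iff_monomialParam k) hqw ⟨2, hw2'⟩ hw hm
    (hwc.exists_independent_values hw hm ⟨2, hw2'⟩)).mp hC
  exact degree_le_degree_image hΛM (F := ![X 0, X 1])
    (fun i => by fin_cases i <;> exact isHomogeneous_X _ _)
    (pow_ne_zero _ (X_ne_zero _)) (aeval_monomialParam_X k) hqw one_ne_zero hw hm hwc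
    ⟨2, hw2'⟩ hCw

/-- The quadratic transformation `(x² : x z : y z)`. -/
noncomputable def monomialMap (K : Type*) [Field K] : PlaneRationalMap K where
  degree := 2
  form := ![X 0 ^ 2, X 0 * X 2, X 1 * X 2]
  homogeneous i := by
    fin_cases i
    · exact isHomogeneous_X_pow 0 2
    · exact isHomogeneous_X_mul_X 0 2
    · exact isHomogeneous_X_mul_X 1 2
  noCommonFactor := noCommonFactor_of_isRelPrime 0 2
    (isRelPrime_X_pow ![0, 1, 1] rfl (by simp) 2)

/-- The quadratic transformation `(x y : x z : y²)`. -/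
noncomputable def monomialMapInv (K : Type*) [Field K] : PlaneRationalMap K where
  degree := 2
  form := ![X 0 * X 1, X 0 * X 2, X 1 ^ 2]
  homogeneous i := by
    fin_cases i
    · exact isHomogeneous_X_mul_X 0 1
    · exact isHomogeneous_X_mul_X 0 2
    · exact isHomogeneous_X_pow 1 2
  noCommonFactor := noCommonFactor_of_isRelPrime 2 1
    (isRelPrime_X_pow ![1, 0, 1] rfl (by simp) 2)

theorem monomialMap_isInverse : (monomialMap K).IsInverse (monomialMapInv K) := by
  refine ⟨⟨X 0 ^ 2 * X 2, mul_ne_zero (pow_ne_zero _ (X_ne_zero _)) (X_ne_zero _), fun i => ?_⟩,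
    ⟨X 0 * X 1 ^ 2, mul_ne_zero (X_ne_zero _) (pow_ne_zero _ (X_ne_zero _)), fun i => ?_⟩⟩ <;>
  fin_cases i <;> simp [monomialMap, monomialMapInv] <;> ring

/-- The base points `(0 : 0 : 1)` and `(0 : 1 : 0)` both lie on the curve, the first with
multiplicity `k + 1`. The factor `X 0 ^ 2 * X 1 ^ (k + 1)` cancels, of degree `n + 2` for `n = k +
1`. -/
theorem lower_bound_attained [IsAlgClosed K] (k : ℕ) :
    ∃ (C : PlaneCurve K) (Λ : PlaneRationalMap K), Λ.IsQuadraticWithQuadraticInverse ∧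
      C.points = zariskiClosure (Λ.image (monomialCurve K k).points) ∧ C.degree = k + 1 := by
  have hΛM := monomialMap_isInverse (K := K)
  have hΛq : (monomialMap K).IsQuadraticWithQuadraticInverse := ⟨⟨rfl, _, hΛM⟩, _, rfl, hΛM⟩
  obtain ⟨⟨C, hC⟩, hbounds⟩ := quadratic_image_degree_bounds (monomialCurve K k) (monomialMap K)
    (by change 1 < k + 2; omega) (monomialCurve_isParameterizableByLines k) hΛq
  refine ⟨C, monomialMap K, hΛq, hC, le_antisymm ?_ (hbounds C hC).1⟩
  set w : Fin 3 → MvPolynomial (Fin 2) K := ![X 1 ^ (k + 1), X 0 ^ (k + 1), X 1 * X 0 ^ k] with hwdef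
  have hw : ∀ i, (w i).IsHomogeneous (k + 1) := fun i => by
    fin_cases i
    · exact isHomogeneous_X_pow _ _
    · exact isHomogeneous_X_pow _ _
    · rw [add_comm]
      exact (isHomogeneous_X K 1).mul (isHomogeneous_X_pow 0 k)
  have hwc : NoCommonFactor w := noCommonFactor_of_isRelPrime 0 1
    (isRelPrime_X_pow ![1, 0] rfl (by simp [hwdef]) _)
  have hw0 : ∃ i, w i ≠ 0 := ⟨0, pow_ne_zero _ (X_ne_zero _)⟩
  have hqw : ∀ i, aeval (monomialParam K k) ((monomialMap K).form i) =
      X 0 ^ 2 * X 1 ^ (k + 1) * w i := fun i => by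
    fin_cases i <;> simp [hwdef, monomialMap, monomialParam] <;> ring
  have hq0 : (X 0 ^ 2 * X 1 ^ (k + 1) : MvPolynomial (Fin 2) K) ≠ 0 :=
    mul_ne_zero (pow_ne_zero _ (X_ne_zero _)) (pow_ne_zero _ (X_ne_zero _))
  have hm : 1 ≤ k + 1 := by omega
  have hCw := (points_eq_zariskiClosure_iff (monomialCurve K k) C (monomialMap K) two_ne_zero
    (dvd_iff_monomialParam k) hqw
    ⟨0, by rw [hqw]; exact mul_ne_zero hq0 (pow_ne_zero _ (X_ne_zero _))⟩ hw hm
    (hwc.exists_independent_values hw hm hw0)).mp hC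
  -- A form of degree `k + 1` vanishing along `w` suffices, since the equation of the image divides
  -- it; irreducibility of `G` is not needed.
  set G : MvPolynomial (Fin 3) K := X 2 ^ (k + 1) - X 0 * X 1 ^ k with hG
  have hGh : G.IsHomogeneous (k + 1) := by
    refine (isHomogeneous_X_pow _ _).sub ?_
    rw [add_comm]
    exact (isHomogeneous_X K 0).mul (isHomogeneous_X_pow 1 k)
  have hG0 : G ≠ 0 := fun h => by
    have := congrArg (eval ![(0 : K), 0, 1]) h
    simp [hG] at this
  have hGw : aeval w G = 0 := by
    simp [hG, hwdef]
    ring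
  have hdvd := (dvd_iff_of_parameterizes C.irreducible hw hm hwc hw0 hCw G).mpr hGw
  rw [← C.homogeneous.totalDegree C.irreducible.ne_zero]
  exact (totalDegree_le_of_dvd_of_isDomain hdvd hG0).trans hGh.totalDegree_le

end Sharpness

theorem proposition3p6 {K : Type*} [Field K] [IsAlgClosed K] :
    -- the closure of the image is a curve, and its degree obeys the two bounds
    (∀ (C₀ : PlaneCurve K) (Λ : PlaneRationalMap K),
      1 < C₀.degree → C₀.IsParameterizableByLines → Λ.IsQuadraticWithQuadraticInverse →
        (∃ C : PlaneCurve K, C.points = zariskiClosure (Λ.image C₀.points)) ∧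
        ∀ C : PlaneCurve K, C.points = zariskiClosure (Λ.image C₀.points) →
          C₀.degree - 1 ≤ C.degree ∧ C.degree ≤ 2 * C₀.degree) ∧
    -- in every degree `d > 1`, the lower bound is attained
    (∀ d : ℕ, 1 < d → ∃ (C₀ C : PlaneCurve K) (Λ : PlaneRationalMap K),
      C₀.degree = d ∧ C₀.IsParameterizableByLines ∧ C₀.HasMultiplicityAtOrigin (d - 1) ∧
        Λ.IsQuadraticWithQuadraticInverse ∧
        C.points = zariskiClosure (Λ.image C₀.points) ∧ C.degree = d - 1) ∧
    -- in every degree `d > 1`, the upper bound is attained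
    (∀ d : ℕ, 1 < d → ∃ (C₀ C : PlaneCurve K) (Λ : PlaneRationalMap K),
      C₀.degree = d ∧ C₀.IsParameterizableByLines ∧ C₀.HasMultiplicityAtOrigin (d - 1) ∧
        Λ.IsQuadraticWithQuadraticInverse ∧
        C.points = zariskiClosure (Λ.image C₀.points) ∧ C.degree = 2 * d) := by
  refine ⟨quadratic_image_degree_bounds, fun d hd => ?_, fun d hd => ?_⟩
  all_goals obtain ⟨k, rfl⟩ : ∃ k, d = k + 2 := ⟨d - 2, by omega⟩
  · obtain ⟨C, Λ, hΛ, hC, hdeg⟩ := lower_bound_attained (K := K) k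
    exact ⟨monomialCurve K k, C, Λ, rfl, monomialCurve_isParameterizableByLines k,
      monomialCurve_hasMultiplicity k, hΛ, hC, hdeg⟩
  · obtain ⟨C, Λ, hΛ, hC, hdeg⟩ := upper_bound_attained (K := K) k
    exact ⟨monomialCurve K k, C, Λ, rfl, monomialCurve_isParameterizableByLines k,
      monomialCurve_hasMultiplicity k, hΛ, hC, hdeg⟩
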